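/- **Conventions.** System $\mathsf T$ is Gödel's system: the simply typed $\lambda$-calculus over the atomic types $\mathtt N,\mathtt{Bool}$ with products, conditionals and primitive recursion in all finite types; $=$ denotes provable equality ($\beta$, projection, conditional and recursion equations, closed under congruence). A *predicate* is a closed normal term $P:\mathtt N^{k+1}\to\mathtt{Bool}$ of $\mathsf T$; an *atom* is a triple $\langle P,\vec n,m\rangle$ with $P\vec n m=\mathrm{True}$ in $\mathsf T$; a *state* is a finite set of atoms containing no two atoms $\langle P,\vec n,m\rangle,\langle P,\vec n,m'\rangle$ with $m\ne m'$. The consistent union $S_1\Cup S_2$ is $S_1\cup S_2$ minus the atoms of $S_2$ inconsistent with some atom of $S_1$. Add to $\mathsf T$ an atomic type $\mathtt S$ and a constant $s:\mathtt S$ for each state. $\mathsf T_{\mathrm{Class}}$ has further the constants $\Cup:\mathtt S\to\mathtt S\to\mathtt S$, $X_P:\mathtt N^k\to\mathtt{Bool}$, $\Phi_P:\mathtt N^k\to\mathtt N$, $\mathsf{Add}_P:\mathtt N^{k+1}\to\mathtt S$ (no new reduction rules). $\mathsf T_{\mathrm{Learn}}$ has instead $\Cup$, $\chi_P:\mathtt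 S\to\mathtt N^k\to\mathtt{Bool}$, $\varphi_P:\mathtt S\to\mathtt N^k\to\mathtt N$, $\mathsf{add}_P:\mathtt S\to\mathtt N^{k+1}\to\mathtt S$ with the following rules for state constants and numerals: $s_1\Cup s_2$ reduces to the constant for the consistent union; if $\langle P,\vec n,m\rangle\in s$ for some $m$ then $\chi_P s\vec n\mapsto\mathrm{True}$, $\varphi_Ps\vec n\mapsto m$, and otherwise $\chi_Ps\vec n\mapsto\mathrm{False}$, $\varphi_Ps\vec n\mapsto 0$; $\mathsf{add}_Ps\vec nm\mapsto\varnothing$ if $\langle P,\vec n,l\rangle\in s$ for some $l$ or $P\vec nm=\mathrm{False}$, and $\mathsf{add}_Ps\vec nm\mapsto\{\langle P,\vec n,m\rangle\}$ otherwise. For $t$ in $\mathsf T_{\mathrm{Class}}$ and a state $s$, $t[s]$ is the term of $\mathsf T_{\mathrm{Learn}}$ obtained by replacing $X_P,\Phi_P,\mathsf{Add}_P$ by $\chi_Ps,\varphi_Ps,\mathsf{add}_Ps$. A term of $\mathsf T_{\mathrm{Class}}$ *has state $\varnothing$* if it contains no state constant other than $\varnothing$. For a closed term $t$ of $\mathsf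 T_{\mathrm{Class}}$ of state $\varnothing$ and a closed arithmetical formula $A$, with $t$ of the type of realizers of $A$ ($\mathtt S$ for atomic formulas; $|A|\times|B|$ for $A\wedge B$; $\mathtt{Bool}\times(|A|\times|B|)$ for $A\vee B$; $|A|\to|B|$ for $A\to B$; $\mathtt N\to|A|$ for $\forall xA$; $\mathtt N\times|A|$ for $\exists xA$), the relation $t\Vdash_sA$ is defined by recursion on $A$: $t\Vdash_s A$ for atomic $A$ iff $t[s]=\varnothing$ implies $A[s]=\mathrm{True}$; $t\Vdash_sA\wedge B$ iff $\pi_0t\Vdash_sA$ and $\pi_1t\Vdash_sB$; $t\Vdash_sA\vee B$ iff $p_0t[s]=\mathrm{True}$ and $p_1t\Vdash_sA$, or $p_0t[s]=\mathrm{False}$ and $p_2t\Vdash_sB$ ($p_0,p_1,p_2$ the ternary projections); $t\Vdash_sA\to B$ iff $u\Vdash_sA$ implies $tu\Vdash_sB$ for all $u$; $t\Vdash_s\forall xA$ iff $tn\Vdash_sA[n/x]$ for all numerals $n$; $t\Vdash_s\exists xA$ iff for some numeral $n$, $\pi_0t[s]=n$ and $\pi_1t\Vdash_sA[n/x]$ (equalities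 in $\mathsf T_{\mathrm{Learn}}$). Finally $t\Vdash A$ iff $t\Vdash_sA$ for all states $s$. **Theorem.** (1) For every closed term $t:\mathtt N\to\mathtt S$ of $\mathsf T_{\mathrm{Class}}$ of state $\varnothing$ there is a closed term $\mathsf{Zero}:\mathtt N\to\mathtt S$ of $\mathsf T_{\mathrm{Learn}}$ such that for every numeral $n$, $\mathsf{Zero}\,n$ is equal in $\mathsf T_{\mathrm{Learn}}$ to a state constant $s$ with $(t\,n)[s]=\varnothing$ in $\mathsf T_{\mathrm{Learn}}$. (2) From a closed term $t$ of $\mathsf T_{\mathrm{Class}}$ one can effectively define (that is, by a computable function on Gödel numbers of terms) a closed term $u:\mathtt N\to\mathtt N$ of Gödel's system $\mathsf T$ such that, whenever $t\Vdash\forall x^{\mathtt N}\exists y^{\mathtt N}\,Pxy$ with $Pxy$ an atomic formula of $\mathsf T$ (that is, $Pxy$ is $Q\,t_1\ldots t_k$ with $Q:\mathtt N^k\to\mathtt{Bool}$ a closed term of $\mathsf T$ and $t_1,\dots,t_k:\mathtt N$ terms of $\mathsf T$ with free variables among $x,y$), one has $Pn(un)=\mathrm{True}$ in $\mathsf T$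 for every numeral $n$. -/

import Mathlib

namespace LearningRealizability

/-! ## Typed terms of Gödel's system T and of its extensions by atomic types and constants -/

/-- Simple types over `Nat`, `Bool` and a family `B` of additional atomic types. -/
inductive Ty (B : Type) : Type
  | nat : Ty B
  | bool : Ty B
  | atom : B → Ty B
  | prod : Ty B → Ty B → Ty B
  | arrow : Ty B → Ty B → Ty B

infixr:60 " ⇒ₜ " => Ty.arrow

/-- `Ty.curry k A` is the type `Nat → ⋯ → Nat → A` with `k` arguments. -/
def Ty.curry {B : Type} : ℕ → Ty B → Ty B
  | 0, A => A
  | k + 1, A => Ty.nat ⇒ₜ Ty.curry k A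

/-- Typed de Bruijn variables. -/
inductive Var {B : Type} : List (Ty B) → Ty B → Type
  | z {Γ : List (Ty B)} {A : Ty B} : Var (A :: Γ) A
  | s {Γ : List (Ty B)} {A U : Ty B} : Var Γ A → Var (U :: Γ) A

/-- Terms of system T (with additional atomic types `B`) extended by the constants `C A` of
type `A`; `Tm C Γ A` is the set of terms of type `A` with free variables in the context `Γ`, up
to renaming of bound variables. A closed term has context `[]`. -/
inductive Tm {B : Type} (C : Ty B → Type) : List (Ty B) → Ty B → Type
  | var {Γ : List (Ty B)} {A : Ty B} : Var Γ A → Tm C Γ A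
  | const {Γ : List (Ty B)} {A : Ty B} : C A → Tm C Γ A
  | zero {Γ : List (Ty B)} : Tm C Γ Ty.nat
  | tt {Γ : List (Ty B)} : Tm C Γ Ty.bool
  | ff {Γ : List (Ty B)} : Tm C Γ Ty.bool
  | ite {Γ : List (Ty B)} (A : Ty B) : Tm C Γ (Ty.bool ⇒ₜ A ⇒ₜ A ⇒ₜ A)
  | recr {Γ : List (Ty B)} (A : Ty B) :
      Tm C Γ (A ⇒ₜ (Ty.nat ⇒ₜ A ⇒ₜ A) ⇒ₜ Ty.nat ⇒ₜ A)
  | succ {Γ : List (Ty B)} : Tm C Γ Ty.nat → Tm C Γ Ty.nat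
  | app {Γ : List (Ty B)} {U V : Ty B} : Tm C Γ (U ⇒ₜ V) → Tm C Γ U → Tm C Γ V
  | fst {Γ : List (Ty B)} {U V : Ty B} : Tm C Γ (Ty.prod U V) → Tm C Γ U
  | snd {Γ : List (Ty B)} {U V : Ty B} : Tm C Γ (Ty.prod U V) → Tm C Γ V
  | pair {Γ : List (Ty B)} {U V : Ty B} : Tm C Γ U → Tm C Γ V → Tm C Γ (Ty.prod U V)
  | lam {Γ : List (Ty B)} {U V : Ty B} : Tm C (U :: Γ) V → Tm C Γ (U ⇒ₜ V)

namespace Tm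

variable {B : Type} {C : Ty B → Type}

/-- Lifting of a renaming under a binder. -/
def liftRen {Γ Δ : List (Ty B)} {U : Ty B} (ρ : ∀ A, Var Γ A → Var Δ A) :
    ∀ A, Var (U :: Γ) A → Var (U :: Δ) A
  | _, .z => .z
  | _, .s v => .s (ρ _ v)

/-- Renaming of free variables. -/
def ren : {Γ Δ : List (Ty B)} → {A : Ty B} → (∀ A, Var Γ A → Var Δ A) → Tm C Γ A → Tm C Δ A
  | _, _, _, ρ, .var v => .var (ρ _ v)
  | _, _, _, _, .const c => .const c
  | _, _, _, _, .zero => .zero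
  | _, _, _, _, .tt => .tt
  | _, _, _, _, .ff => .ff
  | _, _, _, _, .ite A => .ite A
  | _, _, _, _, .recr A => .recr A
  | _, _, _, ρ, .succ t => .succ (ren ρ t)
  | _, _, _, ρ, .app t u => .app (ren ρ t) (ren ρ u)
  | _, _, _, ρ, .fst t => .fst (ren ρ t)
  | _, _, _, ρ, .snd t => .snd (ren ρ t)
  | _, _, _, ρ, .pair t u => .pair (ren ρ t) (ren ρ u)
  | _, _, _, ρ, .lam t => .lam (ren (liftRen ρ) t)

/-- Lifting of a substitution under a binder. -/
def liftSub {Γ Δ : List (Ty B)} {U : Ty B} (σ : ∀ A, Var Γ A → Tm C Δ A) :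
    ∀ A, Var (U :: Γ) A → Tm C (U :: Δ) A
  | _, .z => .var .z
  | _, .s v => ren (fun _ w => .s w) (σ _ v)

/-- Simultaneous capture-avoiding substitution. -/
def sub : {Γ Δ : List (Ty B)} → {A : Ty B} → (∀ A, Var Γ A → Tm C Δ A) → Tm C Γ A → Tm C Δ A
  | _, _, _, σ, .var v => σ _ v
  | _, _, _, _, .const c => .const c
  | _, _, _, _, .zero => .zero
  | _, _, _, _, .tt => .tt
  | _, _, _, _, .ff => .ff
  | _, _, _, _, .ite A => .ite A
  | _, _, _, _, .recr A => .recr A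
  | _, _, _, σ, .succ t => .succ (sub σ t)
  | _, _, _, σ, .app t u => .app (sub σ t) (sub σ u)
  | _, _, _, σ, .fst t => .fst (sub σ t)
  | _, _, _, σ, .snd t => .snd (sub σ t)
  | _, _, _, σ, .pair t u => .pair (sub σ t) (sub σ u)
  | _, _, _, σ, .lam t => .lam (sub (liftSub σ) t)

/-- The substitution replacing the variable `0` by `u`. -/
def single {Γ : List (Ty B)} {U : Ty B} (u : Tm C Γ U) : ∀ A, Var (U :: Γ) A → Tm C Γ A
  | _, .z => u
  | _, .s v => .var v

/-- `t[u/x]`, where `x` is the variable `0` of `t`. -/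
def inst {Γ : List (Ty B)} {U A : Ty B} (t : Tm C (U :: Γ) A) (u : Tm C Γ U) : Tm C Γ A :=
  sub (single u) t

/-- The numeral `S^n(0)`. -/
def numeral {Γ : List (Ty B)} : ℕ → Tm C Γ Ty.nat
  | 0 => .zero
  | n + 1 => .succ (numeral n)

/-- `t v₀ ⋯ v_{k-1}`. -/
def apps {Γ : List (Ty B)} {A : Ty B} :
    (k : ℕ) → Tm C Γ (Ty.curry k A) → (Fin k → Tm C Γ Ty.nat) → Tm C Γ A
  | 0, t, _ => t
  | k + 1, t, v => apps k (.app t (v 0)) (fun i => v i.succ)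

/-- `t n₀ ⋯ n_{k-1}` for numbers `n₀, …, n_{k-1}`, read as numerals. -/
def appNums {Γ : List (Ty B)} {A : Ty B} {k : ℕ} (t : Tm C Γ (Ty.curry k A)) (n : Fin k → ℕ) :
    Tm C Γ A :=
  apps k t (fun i => numeral (n i))

/-- All constants of a term satisfy `p`. -/
def AllConst (p : ∀ A, C A → Prop) : {Γ : List (Ty B)} → {A : Ty B} → Tm C Γ A → Prop
  | _, _, .var _ => True
  | _, _, .const c => p _ c
  | _, _, .zero => True
  | _, _, .tt => True
  | _, _, .ff => True
  | _, _, .ite _ => True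
  | _, _, .recr _ => True
  | _, _, .succ t => AllConst p t
  | _, _, .app t u => AllConst p t ∧ AllConst p u
  | _, _, .fst t => AllConst p t
  | _, _, .snd t => AllConst p t
  | _, _, .pair t u => AllConst p t ∧ AllConst p u
  | _, _, .lam t => AllConst p t

/-- Replacement of each constant by a term of another system (over the same types). -/
def mapConst {C' : Ty B → Type} (f : ∀ (Γ : List (Ty B)) (A : Ty B), C A → Tm C' Γ A) :
    {Γ : List (Ty B)} → {A : Ty B} → Tm C Γ A → Tm C' Γ A
  | _, _, .var v => .var v
  | _, _, .const c => f _ _ c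
  | _, _, .zero => .zero
  | _, _, .tt => .tt
  | _, _, .ff => .ff
  | _, _, .ite A => .ite A
  | _, _, .recr A => .recr A
  | _, _, .succ t => .succ (mapConst f t)
  | _, _, .app t u => .app (mapConst f t) (mapConst f u)
  | _, _, .fst t => .fst (mapConst f t)
  | _, _, .snd t => .snd (mapConst f t)
  | _, _, .pair t u => .pair (mapConst f t) (mapConst f u)
  | _, _, .lam t => .lam (mapConst f t)

end Tm

/-! ## Reduction and equational theory -/

/-- A family of additional contraction rules for the constants. -/
abbrev Rules {B : Type} (C : Ty B → Type) : Type :=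
  ∀ (Γ : List (Ty B)) (A : Ty B), Tm C Γ A → Tm C Γ A → Prop

/-- Contraction of a redex: the rules of system T and the additional rules `R`. -/
inductive Contr {B : Type} {C : Ty B → Type} (R : Rules C) :
    {Γ : List (Ty B)} → {A : Ty B} → Tm C Γ A → Tm C Γ A → Prop
  | beta {Γ : List (Ty B)} {U V : Ty B} (t : Tm C (U :: Γ) V) (u : Tm C Γ U) :
      Contr R (.app (.lam t) u) (t.inst u)
  | fst {Γ : List (Ty B)} {U V : Ty B} (u : Tm C Γ U) (v : Tm C Γ V) :
      Contr R (.fst (.pair u v)) u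
  | snd {Γ : List (Ty B)} {U V : Ty B} (u : Tm C Γ U) (v : Tm C Γ V) :
      Contr R (.snd (.pair u v)) v
  | recZero {Γ : List (Ty B)} {A : Ty B} (u : Tm C Γ A) (v : Tm C Γ (Ty.nat ⇒ₜ A ⇒ₜ A)) :
      Contr R (.app (.app (.app (.recr A) u) v) .zero) u
  | recSucc {Γ : List (Ty B)} {A : Ty B} (u : Tm C Γ A) (v : Tm C Γ (Ty.nat ⇒ₜ A ⇒ₜ A))
      (t : Tm C Γ Ty.nat) :
      Contr R (.app (.app (.app (.recr A) u) v) (.succ t))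
        (.app (.app v t) (.app (.app (.app (.recr A) u) v) t))
  | iteTrue {Γ : List (Ty B)} {A : Ty B} (u v : Tm C Γ A) :
      Contr R (.app (.app (.app (.ite A) .tt) u) v) u
  | iteFalse {Γ : List (Ty B)} {A : Ty B} (u v : Tm C Γ A) :
      Contr R (.app (.app (.app (.ite A) .ff) u) v) v
  | rule {Γ : List (Ty B)} {A : Ty B} {t u : Tm C Γ A} : R Γ A t u → Contr R t u

/-- One-step reduction. -/
inductive Step {B : Type} {C : Ty B → Type} (R : Rules C) :
    {Γ : List (Ty B)} → {A : Ty B} → Tm C Γ A → Tm C Γ A → Prop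
  | contr {Γ : List (Ty B)} {A : Ty B} {t u : Tm C Γ A} : Contr R t u → Step R t u
  | succ {Γ : List (Ty B)} {t t' : Tm C Γ Ty.nat} : Step R t t' → Step R (.succ t) (.succ t')
  | appL {Γ : List (Ty B)} {U V : Ty B} {t t' : Tm C Γ (U ⇒ₜ V)} {u : Tm C Γ U} :
      Step R t t' → Step R (.app t u) (.app t' u)
  | appR {Γ : List (Ty B)} {U V : Ty B} {t : Tm C Γ (U ⇒ₜ V)} {u u' : Tm C Γ U} :
      Step R u u' → Step R (.app t u) (.app t u')
  | fst {Γ : List (Ty B)} {U V : Ty B} {t t' : Tm C Γ (Ty.prod U V)} :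
      Step R t t' → Step R (.fst t) (.fst t')
  | snd {Γ : List (Ty B)} {U V : Ty B} {t t' : Tm C Γ (Ty.prod U V)} :
      Step R t t' → Step R (.snd t) (.snd t')
  | pairL {Γ : List (Ty B)} {U V : Ty B} {t t' : Tm C Γ U} {u : Tm C Γ V} :
      Step R t t' → Step R (.pair t u) (.pair t' u)
  | pairR {Γ : List (Ty B)} {U V : Ty B} {t : Tm C Γ U} {u u' : Tm C Γ V} :
      Step R u u' → Step R (.pair t u) (.pair t u')
  | lam {Γ : List (Ty B)} {U V : Ty B} {t t' : Tm C (U :: Γ) V} :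
      Step R t t' → Step R (.lam t) (.lam t')

/-- A term is normal if no reduction step is possible. -/
def Normal {B : Type} {C : Ty B → Type} (R : Rules C) {Γ : List (Ty B)} {A : Ty B}
    (t : Tm C Γ A) : Prop :=
  ∀ t', ¬ Step R t t'

/-- Provable equality in the equational theory. -/
inductive Eqv {B : Type} {C : Ty B → Type} (R : Rules C) :
    {Γ : List (Ty B)} → {A : Ty B} → Tm C Γ A → Tm C Γ A → Prop
  | refl {Γ : List (Ty B)} {A : Ty B} (t : Tm C Γ A) : Eqv R t t
  | symm {Γ : List (Ty B)} {A : Ty B} {t u : Tm C Γ A} : Eqv R t u → Eqv R u t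
  | trans {Γ : List (Ty B)} {A : Ty B} {t u v : Tm C Γ A} : Eqv R t u → Eqv R u v → Eqv R t v
  | contr {Γ : List (Ty B)} {A : Ty B} {t u : Tm C Γ A} : Contr R t u → Eqv R t u
  | succ {Γ : List (Ty B)} {t t' : Tm C Γ Ty.nat} : Eqv R t t' → Eqv R (.succ t) (.succ t')
  | app {Γ : List (Ty B)} {U V : Ty B} {t t' : Tm C Γ (U ⇒ₜ V)} {u u' : Tm C Γ U} :
      Eqv R t t' → Eqv R u u' → Eqv R (.app t u) (.app t' u')
  | fst {Γ : List (Ty B)} {U V : Ty B} {t t' : Tm C Γ (Ty.prod U V)} :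
      Eqv R t t' → Eqv R (.fst t) (.fst t')
  | snd {Γ : List (Ty B)} {U V : Ty B} {t t' : Tm C Γ (Ty.prod U V)} :
      Eqv R t t' → Eqv R (.snd t) (.snd t')
  | pair {Γ : List (Ty B)} {U V : Ty B} {t t' : Tm C Γ U} {u u' : Tm C Γ V} :
      Eqv R t t' → Eqv R u u' → Eqv R (.pair t u) (.pair t' u')
  | lam {Γ : List (Ty B)} {U V : Ty B} {t t' : Tm C (U :: Γ) V} :
      Eqv R t t' → Eqv R (.lam t) (.lam t')

/-! ## Gödel's system T -/

/-- The types of Gödel's system T: no additional atomic type. -/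
abbrev TyT : Type := Ty Empty

/-- Gödel's system T has no additional constants. -/
abbrev NoConst : TyT → Type := fun _ => Empty

/-- Terms of Gödel's system T. -/
abbrev TTm : List TyT → TyT → Type := Tm NoConst

/-- Gödel's system T has no additional rules. -/
def noRules : Rules NoConst := fun _ _ _ _ => False

/-- Provable equality in Gödel's system T. -/
abbrev TEq {Γ : List TyT} {A : TyT} (t u : TTm Γ A) : Prop := Eqv noRules t u

/-! ## States of knowledge -/

/-- A `(k+1)`-ary predicate of system T: a closed normal term of type `Nat^{k+1} → Bool`, written
as `Nat → ⋯ → Nat → (Nat → Bool)` with `k` arguments in front. -/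
structure Pred : Type where
  k : ℕ
  tm : TTm [] (Ty.curry k (Ty.nat ⇒ₜ Ty.bool))
  normal : Normal noRules tm

/-- The closed term `P n₁ ⋯ n_k m`. -/
def Pred.at (P : Pred) (n : Fin P.k → ℕ) (m : ℕ) : TTm [] Ty.bool :=
  .app (P.tm.appNums n) (.numeral m)

/-- An atom `⟨P, n, m⟩` with `P n m = True`; `key` is the pair `⟨P, n⟩`. -/
structure Atom : Type where
  key : (P : Pred) × (Fin P.k → ℕ)
  wit : ℕ
  holds : TEq (key.1.at key.2 wit) .tt

def Atom.Consistent (a b : Atom) : Prop := a.key = b.key → a.wit = b.wit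

/-- A state of knowledge: a finite set of pairwise consistent atoms. -/
structure KState : Type where
  carrier : Set Atom
  finite : carrier.Finite
  consistent : ∀ a ∈ carrier, ∀ b ∈ carrier, a.Consistent b

namespace KState

def empty : KState := ⟨∅, Set.finite_empty, fun _ h => absurd h (Set.notMem_empty _)⟩

def singleton (a : Atom) : KState :=
  ⟨{a}, Set.finite_singleton a, fun x hx y hy _ => by
    rw [Set.mem_singleton_iff] at hx hy; rw [hx, hy]⟩

/-- Consistent union: `S₁ ∪ S₂` minus the atoms of `S₂` inconsistent with some atom of `S₁`. -/
def cup (S₁ S₂ : KState) : KState where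
  carrier := S₁.carrier ∪ {b | b ∈ S₂.carrier ∧ ∀ a ∈ S₁.carrier, a.Consistent b}
  finite := S₁.finite.union (S₂.finite.subset fun _ h => h.1)
  consistent := by
    rintro a (ha | ha) b (hb | hb)
    · exact S₁.consistent a ha b hb
    · exact hb.2 a ha
    · exact fun h => (ha.2 b hb h.symm).symm
    · exact S₂.consistent a ha.1 b hb.1

/-- `⟨P, n, m⟩ ∈ S`. -/
def Mem (S : KState) (P : Pred) (n : Fin P.k → ℕ) (m : ℕ) : Prop :=
  ∃ a ∈ S.carrier, a.key = ⟨P, n⟩ ∧ a.wit = m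

end KState

/-! ## The systems with an atomic type of states -/

/-- Types with one additional atomic type of states. -/
abbrev TyS : Type := Ty Unit

abbrev TyS.state : TyS := Ty.atom ()

/-- The constants of the (non-computable) system of realizers: state constants, consistent union,
and for every predicate `P` the oracle `X_P`, the Skolem map `Φ_P` and `Add_P`. -/
inductive ClassConst : TyS → Type
  | st : KState → ClassConst TyS.state
  | cup : ClassConst (TyS.state ⇒ₜ TyS.state ⇒ₜ TyS.state)
  | oracle (P : Pred) : ClassConst (Ty.curry P.k Ty.bool)
  | skolem (P : Pred) : ClassConst (Ty.curry P.k Ty.nat)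
  | add (P : Pred) : ClassConst (Ty.curry P.k (Ty.nat ⇒ₜ TyS.state))

/-- The constants of the (computable) system of learning processes: state constants, consistent
union, and for every predicate `P` the approximations `χ_P`, `φ_P` and `add_P`. -/
inductive LearnConst : TyS → Type
  | st : KState → LearnConst TyS.state
  | cup : LearnConst (TyS.state ⇒ₜ TyS.state ⇒ₜ TyS.state)
  | chi (P : Pred) : LearnConst (TyS.state ⇒ₜ Ty.curry P.k Ty.bool)
  | phi (P : Pred) : LearnConst (TyS.state ⇒ₜ Ty.curry P.k Ty.nat)
  | add (P : Pred) : LearnConst (TyS.state ⇒ₜ Ty.curry P.k (Ty.nat ⇒ₜ TyS.state))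

/-- Terms of `T_Class`. -/
abbrev ClassTm : List TyS → TyS → Type := Tm ClassConst

/-- Terms of `T_Learn`. -/
abbrev LearnTm : List TyS → TyS → Type := Tm LearnConst

/-- The state constant of `T_Learn` denoting `S`. -/
def LearnTm.st {Γ : List TyS} (S : KState) : LearnTm Γ TyS.state := .const (.st S)

/-- The algebraic reduction rules of `T_Learn`. -/
inductive LearnRules : Rules LearnConst
  | cup {Γ : List TyS} (S₁ S₂ : KState) :
      LearnRules Γ TyS.state (.app (.app (.const .cup) (LearnTm.st S₁)) (LearnTm.st S₂))
        (LearnTm.st (S₁.cup S₂))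
  | chiTrue {Γ : List TyS} (P : Pred) (S : KState) (n : Fin P.k → ℕ) (m : ℕ) :
      S.Mem P n m →
      LearnRules Γ Ty.bool (Tm.appNums (.app (.const (.chi P)) (LearnTm.st S)) n) .tt
  | chiFalse {Γ : List TyS} (P : Pred) (S : KState) (n : Fin P.k → ℕ) :
      (¬ ∃ m, S.Mem P n m) →
      LearnRules Γ Ty.bool (Tm.appNums (.app (.const (.chi P)) (LearnTm.st S)) n) .ff
  | phiSome {Γ : List TyS} (P : Pred) (S : KState) (n : Fin P.k → ℕ) (m : ℕ) :
      S.Mem P n m →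
      LearnRules Γ Ty.nat (Tm.appNums (.app (.const (.phi P)) (LearnTm.st S)) n) (.numeral m)
  | phiNone {Γ : List TyS} (P : Pred) (S : KState) (n : Fin P.k → ℕ) :
      (¬ ∃ m, S.Mem P n m) →
      LearnRules Γ Ty.nat (Tm.appNums (.app (.const (.phi P)) (LearnTm.st S)) n) .zero
  | addEmpty {Γ : List TyS} (P : Pred) (S : KState) (n : Fin P.k → ℕ) (m : ℕ) :
      ((∃ l, S.Mem P n l) ∨ TEq (P.at n m) .ff) →
      LearnRules Γ TyS.state
        (.app (Tm.appNums (.app (.const (.add P)) (LearnTm.st S)) n) (.numeral m))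
        (LearnTm.st KState.empty)
  | addNew {Γ : List TyS} (P : Pred) (S : KState) (n : Fin P.k → ℕ) (m : ℕ)
      (h : TEq (P.at n m) .tt) :
      (¬ ∃ l, S.Mem P n l) →
      LearnRules Γ TyS.state
        (.app (Tm.appNums (.app (.const (.add P)) (LearnTm.st S)) n) (.numeral m))
        (LearnTm.st (KState.singleton ⟨⟨P, n⟩, m, h⟩))

/-- Provable equality in `T_Learn`. -/
abbrev LearnEq {Γ : List TyS} {A : TyS} (t u : LearnTm Γ A) : Prop := Eqv LearnRules t u

/-- The constant is not a state constant different from `∅`. -/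
def ClassConst.StateEmpty : ∀ A : TyS, ClassConst A → Prop
  | _, .st S => S = KState.empty
  | _, _ => True

/-- A term of `T_Class` has state `∅` if it has no state constant different from `∅`. -/
def ClassTm.StateEmpty {Γ : List TyS} {A : TyS} (t : ClassTm Γ A) : Prop :=
  Tm.AllConst ClassConst.StateEmpty t

/-- The term of `T_Learn` replacing a constant of `T_Class` in the approximation at `S`. -/
def ClassConst.approx (S : KState) (Γ : List TyS) : ∀ A : TyS, ClassConst A → LearnTm Γ A
  | _, .st S' => LearnTm.st S'
  | _, .cup => .const .cup
  | _, .oracle P => .app (.const (.chi P)) (LearnTm.st S)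
  | _, .skolem P => .app (.const (.phi P)) (LearnTm.st S)
  | _, .add P => .app (.const (.add P)) (LearnTm.st S)

/-- The approximation `t[S]` of a term `t` of `T_Class` at the state `S`. -/
def ClassTm.approx (S : KState) {Γ : List TyS} {A : TyS} (t : ClassTm Γ A) : LearnTm Γ A :=
  Tm.mapConst (ClassConst.approx S) t

/-! ## System T inside `T_Class` -/

def Ty.lift : TyT → TyS
  | .nat => .nat
  | .bool => .bool
  | .atom e => nomatch e
  | .prod U V => .prod (Ty.lift U) (Ty.lift V)
  | .arrow U V => .arrow (Ty.lift U) (Ty.lift V)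

def Var.lift : {Γ : List TyT} → {A : TyT} → Var Γ A → Var (Γ.map Ty.lift) (Ty.lift A)
  | _, _, .z => .z
  | _, _, .s v => .s (Var.lift v)

/-- A term of system T, read as a term of `T_Class`. -/
def TTm.toClass : {Γ : List TyT} → {A : TyT} → TTm Γ A → ClassTm (Γ.map Ty.lift) (Ty.lift A)
  | _, _, .var v => .var (Var.lift v)
  | _, _, .const c => nomatch c
  | _, _, .zero => .zero
  | _, _, .tt => .tt
  | _, _, .ff => .ff
  | _, _, .ite A => .ite (Ty.lift A)
  | _, _, .recr A => .recr (Ty.lift A)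
  | _, _, .succ t => .succ (TTm.toClass t)
  | _, _, .app t u => .app (TTm.toClass t) (TTm.toClass u)
  | _, _, .fst t => .fst (TTm.toClass t)
  | _, _, .snd t => .snd (TTm.toClass t)
  | _, _, .pair t u => .pair (TTm.toClass t) (TTm.toClass u)
  | _, _, .lam t => .lam (TTm.toClass t)

theorem TTm.toClass_stateEmpty : {Γ : List TyT} → {A : TyT} → (t : TTm Γ A) →
    ClassTm.StateEmpty (TTm.toClass t)
  | _, _, .var _ => trivial
  | _, _, .const c => nomatch c
  | _, _, .zero => trivial
  | _, _, .tt => trivial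
  | _, _, .ff => trivial
  | _, _, .ite _ => trivial
  | _, _, .recr _ => trivial
  | _, _, .succ t => TTm.toClass_stateEmpty t
  | _, _, .app t u => ⟨TTm.toClass_stateEmpty t, TTm.toClass_stateEmpty u⟩
  | _, _, .fst t => TTm.toClass_stateEmpty t
  | _, _, .snd t => TTm.toClass_stateEmpty t
  | _, _, .pair t u => ⟨TTm.toClass_stateEmpty t, TTm.toClass_stateEmpty u⟩
  | _, _, .lam t => TTm.toClass_stateEmpty t

theorem Ty.lift_curry : (k : ℕ) → (A : TyT) → Ty.lift (Ty.curry k A) = Ty.curry k (Ty.lift A)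
  | 0, _ => rfl
  | k + 1, A => congrArg (Ty.arrow Ty.nat) (Ty.lift_curry k A)

/-- A closed term `Q : Nat^k → Bool` of system T, read as a term of `T_Class`. -/
def TTm.toClassFun {k : ℕ} (Q : TTm [] (Ty.curry k Ty.bool)) : ClassTm [] (Ty.curry k Ty.bool) :=
  cast (congrArg (ClassTm []) (Ty.lift_curry k Ty.bool)) (TTm.toClass Q)

theorem TTm.toClassFun_stateEmpty {k : ℕ} (Q : TTm [] (Ty.curry k Ty.bool)) :
    ClassTm.StateEmpty (TTm.toClassFun Q) := by
  have h : ∀ {A A' : TyS} (e : A = A') (t : ClassTm [] A), t.StateEmpty →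
      ClassTm.StateEmpty (cast (congrArg (ClassTm []) e) t) := by
    intro A A' e t ht; subst e; exact ht
  exact h (Ty.lift_curry k Ty.bool) _ (TTm.toClass_stateEmpty Q)

/-! ## Formulas and realizability -/

/-- The context of `n` variables of type `Nat`. -/
def natCtx : ℕ → List TyS
  | 0 => []
  | n + 1 => Ty.nat :: natCtx n

/-- Arithmetical formulas with `n` free variables (de Bruijn, the variable `0` is the one bound
innermost). An atomic formula is `Q t₁ ⋯ t_k` for a closed term `Q : Nat^k → Bool` of `T_Class`
and terms `t₁, …, t_k : Nat` of `T_Class`, all of state `∅`. -/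
inductive Formula : ℕ → Type
  | atom {n : ℕ} (k : ℕ) (Q : ClassTm [] (Ty.curry k Ty.bool)) (hQ : Q.StateEmpty)
      (ts : Fin k → ClassTm (natCtx n) Ty.nat) (hts : ∀ i, (ts i).StateEmpty) : Formula n
  | and {n : ℕ} : Formula n → Formula n → Formula n
  | or {n : ℕ} : Formula n → Formula n → Formula n
  | imp {n : ℕ} : Formula n → Formula n → Formula n
  | all {n : ℕ} : Formula (n + 1) → Formula n
  | ex {n : ℕ} : Formula (n + 1) → Formula n

/-- The type of the realizers of a formula. -/
def Formula.rtype : {n : ℕ} → Formula n → TyS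
  | _, .atom _ _ _ _ _ => TyS.state
  | _, .and A B => .prod A.rtype B.rtype
  | _, .or A B => .prod .bool (.prod A.rtype B.rtype)
  | _, .imp A B => A.rtype ⇒ₜ B.rtype
  | _, .all A => Ty.nat ⇒ₜ A.rtype
  | _, .ex A => .prod .nat A.rtype

/-- The substitution of the numerals `ρ 0, …, ρ (n - 1)` for the `n` variables. -/
def numSub : (n : ℕ) → (Fin n → ℕ) → ∀ A, Var (natCtx n) A → ClassTm [] A
  | _ + 1, ρ, _, .z => .numeral (ρ 0)
  | n + 1, ρ, _, .s v => numSub n (fun i => ρ i.succ) _ v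

/-- The ternary projection `λ x. π₀ (π₁ x)`, applied to `t`. -/
def proj1 {U V W : TyS} (t : ClassTm [] (.prod U (.prod V W))) : ClassTm [] V :=
  .app (.lam (.fst (.snd (.var .z)))) t

/-- The ternary projection `λ x. π₁ (π₁ x)`, applied to `t`. -/
def proj2 {U V W : TyS} (t : ClassTm [] (.prod U (.prod V W))) : ClassTm [] W :=
  .app (.lam (.snd (.snd (.var .z)))) t

/-- `RealizesAt S A ρ t`: the closed term `t` realizes at the state `S` the closed formula
`A[ρ]`, obtained from `A` by substituting the numerals `ρ` for its free variables. -/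
def RealizesAt (S : KState) : {n : ℕ} → (A : Formula n) → (Fin n → ℕ) → ClassTm [] A.rtype → Prop
  | n, .atom k Q _ ts _, ρ, t =>
      LearnEq (ClassTm.approx S t) (LearnTm.st KState.empty) →
        LearnEq (ClassTm.approx S (Tm.apps k Q fun i => Tm.sub (numSub n ρ) (ts i))) .tt
  | _, .and A B, ρ, t => RealizesAt S A ρ (.fst t) ∧ RealizesAt S B ρ (.snd t)
  | _, .or A B, ρ, t =>
      (LearnEq (ClassTm.approx S (Tm.fst t)) .tt ∧ RealizesAt S A ρ (proj1 t)) ∨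
        (LearnEq (ClassTm.approx S (Tm.fst t)) .ff ∧ RealizesAt S B ρ (proj2 t))
  | _, .imp A B, ρ, t =>
      ∀ u : ClassTm [] A.rtype, u.StateEmpty → RealizesAt S A ρ u → RealizesAt S B ρ (.app t u)
  | _, .all A, ρ, t => ∀ m : ℕ, RealizesAt S A (Fin.cons m ρ) (.app t (.numeral m))
  | _, .ex A, ρ, t =>
      ∃ m : ℕ, LearnEq (ClassTm.approx S (Tm.fst t)) (.numeral m) ∧
        RealizesAt S A (Fin.cons m ρ) (.snd t)

/-- The closed term `t` of `T_Class` (of state `∅`) realizes the closed formula `A`. -/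
def Realizes (A : Formula 0) (t : ClassTm [] A.rtype) : Prop :=
  t.StateEmpty ∧ ∀ S : KState, RealizesAt S A Fin.elim0 t

/-- An atomic formula `P x y` of system T: a term `Q t₁ ⋯ t_k` for a closed term
`Q : Nat^k → Bool` of system T and terms `t₁, …, t_k : Nat` of system T with free variables among
`x` (the variable `1`) and `y` (the variable `0`). -/
structure AtomicT : Type where
  k : ℕ
  Q : TTm [] (Ty.curry k Ty.bool)
  ts : Fin k → TTm [Ty.nat, Ty.nat] Ty.nat

/-- The substitution of `a` for `x` and of `b` for `y`. -/
def pairSub (a b : TTm [] Ty.nat) : ∀ A, Var [Ty.nat, Ty.nat] A → TTm [] A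
  | _, .z => b
  | _, .s .z => a

/-- The closed boolean term `P a b`. -/
def AtomicT.at (P : AtomicT) (a b : TTm [] Ty.nat) : TTm [] Ty.bool :=
  Tm.apps P.k P.Q fun i => Tm.sub (pairSub a b) (P.ts i)

/-- The formula `∀ x ∃ y P x y`. -/
def AtomicT.forallExists (P : AtomicT) : Formula 0 :=
  .all (.ex (.atom P.k (TTm.toClassFun P.Q) (TTm.toClassFun_stateEmpty P.Q)
    (fun i => TTm.toClass (P.ts i)) (fun i => TTm.toClass_stateEmpty (P.ts i))))

/-! ## Gödel numbers -/

def Ty.code {B : Type} (cB : B → ℕ) : Ty B → ℕ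
  | .nat => Nat.pair 0 0
  | .bool => Nat.pair 1 0
  | .atom b => Nat.pair 2 (cB b)
  | .prod U V => Nat.pair 3 (Nat.pair (Ty.code cB U) (Ty.code cB V))
  | .arrow U V => Nat.pair 4 (Nat.pair (Ty.code cB U) (Ty.code cB V))

/-- The de Bruijn index of a variable. -/
def Var.index {B : Type} : {Γ : List (Ty B)} → {A : Ty B} → Var Γ A → ℕ
  | _, _, .z => 0
  | _, _, .s v => Var.index v + 1

/-- The Gödel number of a term, relative to numberings of the atomic types and constants. -/
def Tm.code {B : Type} {C : Ty B → Type} (cB : B → ℕ) (cC : ∀ A, C A → ℕ) :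
    {Γ : List (Ty B)} → {A : Ty B} → Tm C Γ A → ℕ
  | _, _, .var v => Nat.pair 0 v.index
  | _, _, .const c => Nat.pair 1 (cC _ c)
  | _, _, .zero => Nat.pair 2 0
  | _, _, .tt => Nat.pair 3 0
  | _, _, .ff => Nat.pair 4 0
  | _, _, .ite A => Nat.pair 5 (A.code cB)
  | _, _, .recr A => Nat.pair 6 (A.code cB)
  | _, _, .succ t => Nat.pair 7 (Tm.code cB cC t)
  | _, _, .app (U := U) t u =>
      Nat.pair 8 (Nat.pair (U.code cB) (Nat.pair (Tm.code cB cC t) (Tm.code cB cC u)))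
  | _, _, .fst (V := V) t => Nat.pair 9 (Nat.pair (V.code cB) (Tm.code cB cC t))
  | _, _, .snd (U := U) t => Nat.pair 10 (Nat.pair (U.code cB) (Tm.code cB cC t))
  | _, _, .pair t u => Nat.pair 11 (Nat.pair (Tm.code cB cC t) (Tm.code cB cC u))
  | _, _, .lam (U := U) t => Nat.pair 12 (Nat.pair (U.code cB) (Tm.code cB cC t))

/-- Gödel numbers of terms of system T. -/
def TTm.code {Γ : List TyT} {A : TyT} (t : TTm Γ A) : ℕ :=
  Tm.code (fun e => nomatch e) (fun _ c => nomatch c) t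

def Pred.code (P : Pred) : ℕ := Nat.pair P.k (TTm.code P.tm)

def Atom.code (a : Atom) : ℕ :=
  Nat.pair (Nat.pair a.key.1.code (Encodable.encode (List.ofFn a.key.2))) a.wit

/-- The binary code of the finite set of the codes of the atoms. -/
noncomputable def KState.code (S : KState) : ℕ := ∑ᶠ a ∈ S.carrier, 2 ^ a.code

noncomputable def ClassConst.code : ∀ A : TyS, ClassConst A → ℕ
  | _, .st S => Nat.pair 0 S.code
  | _, .cup => Nat.pair 1 0
  | _, .oracle P => Nat.pair 2 P.code
  | _, .skolem P => Nat.pair 3 P.code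
  | _, .add P => Nat.pair 4 P.code

/-- Gödel numbers of terms of `T_Class`. -/
noncomputable def ClassTm.code {Γ : List TyS} {A : TyS} (t : ClassTm Γ A) : ℕ :=
  Tm.code (fun _ => 0) ClassConst.code t

end LearningRealizability

open LearningRealizability

namespace LearningRealizability

/-! For a fixed argument n a realizer yields a map Y from states to states, Y(s) = (t n)[s].
Learning iterates s₀ = ∅, s_{i+1} = s_i ⋓ Y(s_i). The map Y never proposes an atom whose key already
occurs in s (`KState.Fresh`), because `add_P` does not and consistent union preserves this. Hence
Y(s_{m+1}) = Y(s_m) forces Y(s_m) = ∅: an atom of Y(s_m) enters s_{m+1} and can no longer be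
proposed (`KState.eq_empty_of_stationary`). It remains to find such an m by a term of system T.

The point from which a value stays constant along an increasing sequence of states cannot be
computed from the sequence, but a metastable version can: given h and a, find m ≥ a such that the
value is the same on all of [m, h m]. For one entry of the state this is a single test at h a: an
entry absent there is absent on [a, h a], and an entry present there never changes again
(`Converges.lookup`). Metastability is closed under composition (`Converges.bind`). So an object of
base type is translated into its value as a function of the state together with such a modulus, and
the translation extends to all terms by structural recursion. The logical relation `Ty.StarRel` and
its fundamental lemma `Ty.starRel_eval` prove it correct; freshness is carried along at the type of
states. The modulus of Y for h = successor and a = 0 is the required m (`KState.learn_stationary`).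

Provable equality is reduced to equality of values in the standard model: soundness is
`Eqv.eval_eq`, and adequacy is `Computes.eval`, by a second logical relation. Everything else takes
place in the model.

For the first claim, the translation inside `T_Learn` supplies the number of steps, and a recursion
on genuine states performs them. For the second, system T has no states, so they are represented by
functions on codes of keys; the program runs the learning on these functions and reads off the
witness at s_m. There the state part of the realizer is empty, so the atomic formula is true at this
witness, and its truth does not depend on the state. Since the translation is structural, on Gödel
numbers it is a course-of-values recursion, hence primitive recursive (`codeStar_primrec`). -/

/-! ## The standard model -/

/-- The standard interpretation of types; additional atomic types are read as types of states. -/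
def Ty.den {B : Type} : Ty B → Type
  | .nat => ℕ
  | .bool => Bool
  | .atom _ => KState
  | .prod U V => Ty.den U × Ty.den V
  | .arrow U V => Ty.den U → Ty.den V

abbrev Env {B : Type} (Γ : List (Ty B)) : Type := ∀ A, Var Γ A → A.den

def Env.nil {B : Type} : Env ([] : List (Ty B)) := fun _ v => nomatch v

def Env.cons {B : Type} {Γ : List (Ty B)} {U : Ty B} (x : U.den) (ρ : Env Γ) : Env (U :: Γ)
  | _, .z => x
  | _, .s v => ρ _ v

theorem Env.eq_nil {B : Type} (ρ : Env ([] : List (Ty B))) : ρ = Env.nil := by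
  funext A v; cases v

/-- An interpretation of the constants in the standard model. -/
abbrev Interp {B : Type} (C : Ty B → Type) : Type := ∀ A, C A → A.den

namespace Tm

variable {B : Type} {C : Ty B → Type}

/-- The value of a term in the standard model. -/
def eval (I : Interp C) : {Γ : List (Ty B)} → {A : Ty B} → Tm C Γ A → Env Γ → A.den
  | _, _, .var v, ρ => ρ _ v
  | _, _, .const c, _ => I _ c
  | _, _, .zero, _ => (0 : ℕ)
  | _, _, .tt, _ => true
  | _, _, .ff, _ => false
  | _, _, .ite _, _ => fun b u v => bif b then u else v
  | _, _, .recr _, _ => fun u v n => Nat.rec u (fun i r => v i r) n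
  | _, _, .succ t, ρ => Nat.succ (eval I t ρ)
  | _, _, .app t u, ρ => (eval I t ρ) (eval I u ρ)
  | _, _, .fst t, ρ => (eval I t ρ).1
  | _, _, .snd t, ρ => (eval I t ρ).2
  | _, _, .pair t u, ρ => (eval I t ρ, eval I u ρ)
  | _, _, .lam t, ρ => fun x => eval I t (Env.cons x ρ)

theorem eval_ren (I : Interp C) {Γ : List (Ty B)} {A : Ty B} (t : Tm C Γ A) :
    ∀ {Δ : List (Ty B)} (r : ∀ A, Var Γ A → Var Δ A) (ρ : Env Δ),
      eval I (ren r t) ρ = eval I t fun _ v => ρ _ (r _ v) := by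
  induction t with
  | lam t ih =>
    intro Δ r ρ
    funext x
    refine (ih (liftRen r) (Env.cons x ρ)).trans (congrArg (eval I t) ?_)
    funext A v
    cases v <;> rfl
  | succ t ih => intro Δ r ρ; simp only [ren, eval, ih]; rfl
  | app t u iht ihu => intro Δ r ρ; simp only [ren, eval, iht, ihu]
  | fst t ih => intro Δ r ρ; simp only [ren, eval, ih]
  | snd t ih => intro Δ r ρ; simp only [ren, eval, ih]
  | pair t u iht ihu => intro Δ r ρ; simp only [ren, eval, iht, ihu]; rfl
  | _ => intros; rfl

theorem eval_sub (I : Interp C) {Γ : List (Ty B)} {A : Ty B} (t : Tm C Γ A) :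
    ∀ {Δ : List (Ty B)} (σ : ∀ A, Var Γ A → Tm C Δ A) (ρ : Env Δ),
      eval I (sub σ t) ρ = eval I t fun _ v => eval I (σ _ v) ρ := by
  induction t with
  | lam t ih =>
    intro Δ σ ρ
    funext x
    refine (ih (liftSub σ) (Env.cons x ρ)).trans (congrArg (eval I t) ?_)
    funext A v
    cases v with
    | z => rfl
    | s v => exact eval_ren I (σ _ v) _ _
  | succ t ih => intro Δ σ ρ; simp only [sub, eval, ih]; rfl
  | app t u iht ihu => intro Δ σ ρ; simp only [sub, eval, iht, ihu]
  | fst t ih => intro Δ σ ρ; simp only [sub, eval, ih]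
  | snd t ih => intro Δ σ ρ; simp only [sub, eval, ih]
  | pair t u iht ihu => intro Δ σ ρ; simp only [sub, eval, iht, ihu]; rfl
  | _ => intros; rfl

theorem eval_inst (I : Interp C) {Γ : List (Ty B)} {U A : Ty B} (t : Tm C (U :: Γ) A)
    (u : Tm C Γ U) (ρ : Env Γ) : eval I (t.inst u) ρ = eval I t (Env.cons (eval I u ρ) ρ) := by
  refine (eval_sub I t (single u) ρ).trans (congrArg (eval I t) ?_)
  funext A v
  cases v <;> rfl

theorem eval_numeral (I : Interp C) {Γ : List (Ty B)} (n : ℕ) (ρ : Env Γ) :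
    eval I (numeral n : Tm C Γ Ty.nat) ρ = n := by
  induction n with
  | zero => rfl
  | succ n ih => exact congrArg Nat.succ ih

theorem eval_mapConst {C' : Ty B → Type} (I : Interp C) (I' : Interp C')
    (f : ∀ (Γ : List (Ty B)) (A : Ty B), C A → Tm C' Γ A)
    (hf : ∀ Γ A c ρ, eval I' (f Γ A c) ρ = I A c) {Γ : List (Ty B)} {A : Ty B} (t : Tm C Γ A) :
    ∀ ρ, eval I' (mapConst f t) ρ = eval I t ρ := by
  induction t with
  | const c => exact hf _ _ c
  | lam t ih => intro ρ; funext x; exact ih _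
  | succ t ih => intro ρ; simp only [mapConst, eval, ih]; rfl
  | app t u iht ihu => intro ρ; simp only [mapConst, eval, iht, ihu]
  | fst t ih => intro ρ; simp only [mapConst, eval, ih]
  | snd t ih => intro ρ; simp only [mapConst, eval, ih]
  | pair t u iht ihu => intro ρ; simp only [mapConst, eval, iht, ihu]; rfl
  | _ => intros; rfl

end Tm

/-- Application of a `k`-ary function to a vector. -/
def Ty.appsD {B : Type} {A : Ty B} : (k : ℕ) → (Ty.curry k A).den → (Fin k → ℕ) → A.den
  | 0, f, _ => f
  | k + 1, f, v => Ty.appsD k (f (v 0)) fun i => v i.succ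

/-- The `k`-ary function given by a function of a vector. -/
def Ty.curryD {B : Type} {A : Ty B} : (k : ℕ) → ((Fin k → ℕ) → A.den) → (Ty.curry k A).den
  | 0, f => f Fin.elim0
  | k + 1, f => fun x : ℕ => Ty.curryD k fun v => f (Fin.cons x v)

theorem Ty.appsD_curryD {B : Type} {A : Ty B} : (k : ℕ) → (f : (Fin k → ℕ) → A.den) →
    (v : Fin k → ℕ) → Ty.appsD k (Ty.curryD k f) v = f v
  | 0, f, v => congrArg f (Subsingleton.elim _ _)
  | k + 1, f, v => by
    refine (Ty.appsD_curryD k _ _).trans (congrArg f ?_)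
    exact Fin.cons_self_tail v

/-! ### Soundness of provable equality in the standard model. -/

section Soundness

variable {B : Type} {C : Ty B → Type}

theorem Tm.eval_apps (I : Interp C) {Γ : List (Ty B)} {A : Ty B} (ρ : Env Γ) :
    ∀ (k : ℕ) (t : Tm C Γ (Ty.curry k A)) (v : Fin k → Tm C Γ Ty.nat),
      Tm.eval I (Tm.apps k t v) ρ = Ty.appsD k (Tm.eval I t ρ) fun i => Tm.eval I (v i) ρ
  | 0, _, _ => rfl
  | k + 1, _, _ => Tm.eval_apps I ρ k _ _

theorem Tm.eval_appNums (I : Interp C) {Γ : List (Ty B)} {A : Ty B} (ρ : Env Γ) {k : ℕ}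
    (t : Tm C Γ (Ty.curry k A)) (n : Fin k → ℕ) :
    Tm.eval I (t.appNums n) ρ = Ty.appsD k (Tm.eval I t ρ) n := by
  refine (Tm.eval_apps I ρ k t _).trans (congrArg _ ?_)
  funext i
  exact Tm.eval_numeral I _ ρ

/-- β is the substitution lemma and the other contractions of system T hold by computation in the
model, so only the extra rules `R` have to be validated. -/
theorem Eqv.eval_eq {R : Rules C} {I : Interp C}
    (hR : ∀ Γ A (t u : Tm C Γ A), R Γ A t u → ∀ ρ, t.eval I ρ = u.eval I ρ)
    {Γ : List (Ty B)} {A : Ty B} {t u : Tm C Γ A} (h : Eqv R t u) :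
    ∀ ρ, t.eval I ρ = u.eval I ρ := by
  induction h with
  | refl => intro; rfl
  | symm _ ih => exact fun ρ => (ih ρ).symm
  | trans _ _ ih ih' => exact fun ρ => (ih ρ).trans (ih' ρ)
  | contr h =>
    intro ρ
    cases h with
    | beta t u => exact (Tm.eval_inst I t u ρ).symm
    | rule h => exact hR _ _ _ _ h ρ
    | _ => rfl
  | succ _ ih => intro ρ; simp only [Tm.eval, ih]; rfl
  | app _ _ ih ih' => intro ρ; simp only [Tm.eval, ih, ih']
  | fst _ ih => intro ρ; simp only [Tm.eval, ih]
  | snd _ ih => intro ρ; simp only [Tm.eval, ih]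
  | pair _ _ ih ih' => intro ρ; simp only [Tm.eval, ih, ih']; rfl
  | lam _ ih => intro ρ; funext x; exact ih _

end Soundness

/-! ## Substitution -/

namespace Tm

variable {B : Type} {C : Ty B → Type}

theorem sub_ren {Γ : List (Ty B)} {A : Ty B} (t : Tm C Γ A) :
    ∀ {Δ Θ : List (Ty B)} (r : ∀ A, Var Γ A → Var Δ A) (σ : ∀ A, Var Δ A → Tm C Θ A),
      sub σ (ren r t) = sub (fun _ v => σ _ (r _ v)) t := by
  induction t with
  | lam t ih =>
    intro Δ Θ r σ
    simp only [ren, sub, ih]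
    congr 2
    funext A v
    cases v <;> rfl
  | succ t ih => intros; simp only [ren, sub, ih]
  | app t u iht ihu => intros; simp only [ren, sub, iht, ihu]
  | fst t ih => intros; simp only [ren, sub, ih]
  | snd t ih => intros; simp only [ren, sub, ih]
  | pair t u iht ihu => intros; simp only [ren, sub, iht, ihu]
  | _ => intros; rfl

theorem ren_ren {Γ : List (Ty B)} {A : Ty B} (t : Tm C Γ A) :
    ∀ {Δ Θ : List (Ty B)} (r : ∀ A, Var Γ A → Var Δ A) (r' : ∀ A, Var Δ A → Var Θ A),
      ren r' (ren r t) = ren (fun _ v => r' _ (r _ v)) t := by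
  induction t with
  | lam t ih =>
    intro Δ Θ r r'
    simp only [ren, ih]
    congr 2
    funext A v
    cases v <;> rfl
  | succ t ih => intros; simp only [ren, ih]
  | app t u iht ihu => intros; simp only [ren, iht, ihu]
  | fst t ih => intros; simp only [ren, ih]
  | snd t ih => intros; simp only [ren, ih]
  | pair t u iht ihu => intros; simp only [ren, iht, ihu]
  | _ => intros; rfl

theorem ren_sub {Γ : List (Ty B)} {A : Ty B} (t : Tm C Γ A) :
    ∀ {Δ Θ : List (Ty B)} (σ : ∀ A, Var Γ A → Tm C Δ A) (r : ∀ A, Var Δ A → Var Θ A),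
      ren r (sub σ t) = sub (fun _ v => ren r (σ _ v)) t := by
  induction t with
  | lam t ih =>
    intro Δ Θ σ r
    simp only [ren, sub, ih]
    congr 2
    funext A v
    cases v with
    | z => rfl
    | s v => simp only [liftSub, ren_ren, liftRen]
  | succ t ih => intros; simp only [ren, sub, ih]
  | app t u iht ihu => intros; simp only [ren, sub, iht, ihu]
  | fst t ih => intros; simp only [ren, sub, ih]
  | snd t ih => intros; simp only [ren, sub, ih]
  | pair t u iht ihu => intros; simp only [ren, sub, iht, ihu]
  | _ => intros; rfl

theorem sub_sub {Γ : List (Ty B)} {A : Ty B} (t : Tm C Γ A) :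
    ∀ {Δ Θ : List (Ty B)} (σ : ∀ A, Var Γ A → Tm C Δ A) (τ : ∀ A, Var Δ A → Tm C Θ A),
      sub τ (sub σ t) = sub (fun _ v => sub τ (σ _ v)) t := by
  induction t with
  | lam t ih =>
    intro Δ Θ σ τ
    simp only [sub, ih]
    congr 2
    funext A v
    cases v with
    | z => rfl
    | s v => simp only [liftSub, sub_ren, ren_sub]
  | succ t ih => intros; simp only [sub, ih]
  | app t u iht ihu => intros; simp only [sub, iht, ihu]
  | fst t ih => intros; simp only [sub, ih]
  | snd t ih => intros; simp only [sub, ih]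
  | pair t u iht ihu => intros; simp only [sub, iht, ihu]
  | _ => intros; rfl

theorem sub_var {Γ : List (Ty B)} {A : Ty B} (t : Tm C Γ A) : sub (fun _ v => .var v) t = t := by
  have hl : ∀ (Γ : List (Ty B)) (U : Ty B),
      liftSub (U := U) (fun A (v : Var Γ A) => (Tm.var v : Tm C Γ A)) = fun _ v => .var v := by
    intro Γ U
    funext A v
    cases v <;> rfl
  induction t with
  | lam t ih => simp only [sub, hl, ih]
  | succ t ih => simp only [sub, ih]
  | app t u iht ihu => simp only [sub, iht, ihu]
  | fst t ih => simp only [sub, ih]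
  | snd t ih => simp only [sub, ih]
  | pair t u iht ihu => simp only [sub, iht, ihu]
  | _ => rfl

/-- Extension of a closing substitution. -/
def consSub {Γ Δ : List (Ty B)} {U : Ty B} (u : Tm C Δ U) (σ : ∀ A, Var Γ A → Tm C Δ A) :
    ∀ A, Var (U :: Γ) A → Tm C Δ A
  | _, .z => u
  | _, .s v => σ _ v

/-- This is what puts the β-reduct of a substituted abstraction in the form required by the
induction hypothesis of `Computes.sub_eval`. -/
theorem inst_sub_liftSub {Γ Δ : List (Ty B)} {U A : Ty B} (t : Tm C (U :: Γ) A)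
    (σ : ∀ A, Var Γ A → Tm C Δ A) (u : Tm C Δ U) :
    inst (sub (liftSub σ) t) u = sub (consSub u σ) t := by
  refine (sub_sub t _ _).trans ?_
  congr 1
  funext A v
  cases v with
  | z => rfl
  | s v => exact (sub_ren _ _ _).trans (sub_var _)

end Tm

/-! ## Adequacy -/

section Adequacy

variable {B : Type} {C : Ty B → Type}

/-- The closed term `t` computes the value `x`; `st` gives the terms denoting states. -/
def Computes (R : Rules C) (st : ∀ b, KState → Tm C [] (Ty.atom b)) :
    (A : Ty B) → Tm C [] A → A.den → Prop
  | .nat, t, n => Eqv R t (Tm.numeral n)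
  | .bool, t, b => Eqv R t (bif b then .tt else .ff)
  | .atom b, t, S => Eqv R t (st b S)
  | .prod U V, t, x => Computes R st U (.fst t) x.1 ∧ Computes R st V (.snd t) x.2
  | .arrow U V, t, f => ∀ u x, Computes R st U u x → Computes R st V (.app t u) (f x)

variable {R : Rules C} {st : ∀ b, KState → Tm C [] (Ty.atom b)}

/-- Closure under provable equality passes from base types to all types because equality is a
congruence for application and projections. It allows every redex to be replaced by its reduct. -/
theorem Computes.of_eqv : {A : Ty B} → {t t' : Tm C [] A} → {x : A.den} → Eqv R t t' →
    Computes R st A t' x → Computes R st A t x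
  | .nat, _, _, _, h, h' => h.trans h'
  | .bool, _, _, _, h, h' => h.trans h'
  | .atom _, _, _, _, h, h' => h.trans h'
  | .prod _ _, _, _, _, h, h' => ⟨of_eqv (.fst h) h'.1, of_eqv (.snd h) h'.2⟩
  | .arrow _ _, _, _, _, h, h' => fun u x hu => of_eqv (.app h (.refl u)) (h' u x hu)

theorem Computes.of_eq {A : Ty B} {t : Tm C [] A} {x y : A.den} (e : x = y)
    (h : Computes R st A t y) : Computes R st A t x := e ▸ h

theorem Computes.ite (A : Ty B) (I : Interp C) :
    Computes R st _ (.ite A) (Tm.eval I (.ite A : Tm C [] _) Env.nil) := by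
  intro b x hb u y hu v z hv
  have e : Eqv R (.app (.app (.app (.ite A) b) u) v)
      (.app (.app (.app (.ite A) (bif x then .tt else .ff)) u) v) :=
    .app (.app (.app (.refl _) hb) (.refl _)) (.refl _)
  cases x with
  | true => exact of_eqv (e.trans (.contr (.iteTrue u v))) hu
  | false => exact of_eqv (e.trans (.contr (.iteFalse u v))) hv

theorem Computes.recr (A : Ty B) (I : Interp C) :
    Computes R st _ (.recr A) (Tm.eval I (.recr A : Tm C [] _) Env.nil) := by
  intro u x hu v f hv t n ht
  -- The argument is provably equal to a numeral, and on numerals the recursion rules apply by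
  -- induction.
  refine of_eqv (.app (.refl _) ht) ?_
  clear ht
  induction n with
  | zero => exact of_eqv (.contr (.recZero u v)) hu
  | succ n ih => exact of_eqv (.contr (.recSucc u v _)) (hv _ n (.refl _) _ _ ih)

/-- Fundamental lemma of the logical relation `Computes`. It is stated for open terms under closing
substitutions so that the induction passes under λ; only the constants need a separate check. -/
theorem Computes.sub_eval {I : Interp C} (hC : ∀ A (c : C A), Computes R st A (.const c) (I A c))
    {Γ : List (Ty B)} {A : Ty B} (t : Tm C Γ A) :
    ∀ (σ : ∀ A, Var Γ A → Tm C [] A) (ρ : Env Γ), (∀ A v, Computes R st A (σ A v) (ρ A v)) →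
      Computes R st A (t.sub σ) (t.eval I ρ) := by
  induction t with
  | var v => exact fun σ ρ h => h _ v
  | const c => exact fun σ ρ h => hC _ c
  | zero => exact fun σ ρ h => .refl _
  | tt => exact fun σ ρ h => .refl _
  | ff => exact fun σ ρ h => .refl _
  | ite A => exact fun σ ρ h => Computes.ite A I
  | recr A => exact fun σ ρ h => Computes.recr A I
  | succ t ih => exact fun σ ρ h => .succ (ih σ ρ h)
  | app t u iht ihu => exact fun σ ρ h => iht σ ρ h _ _ (ihu σ ρ h)
  | fst t ih => exact fun σ ρ h => (ih σ ρ h).1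
  | snd t ih => exact fun σ ρ h => (ih σ ρ h).2
  | pair t u iht ihu =>
    exact fun σ ρ h => ⟨of_eqv (.contr (.fst _ _)) (iht σ ρ h),
      of_eqv (.contr (.snd _ _)) (ihu σ ρ h)⟩
  | lam t ih =>
    intro σ ρ h u x hu
    refine of_eqv (.contr (.beta _ u)) ?_
    rw [Tm.inst_sub_liftSub]
    refine ih _ (Env.cons x ρ) ?_
    intro A v
    cases v with
    | z => exact hu
    | s v => exact h _ v

theorem Computes.eval {I : Interp C} (hC : ∀ A (c : C A), Computes R st A (.const c) (I A c))
    {A : Ty B} (t : Tm C [] A) : Computes R st A t (t.eval I Env.nil) := by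
  have h := Computes.sub_eval hC t (fun _ v => .var v) Env.nil (fun _ v => nomatch v)
  rwa [Tm.sub_var] at h

/-- A term of type `Nat` that computes a number is provably equal to a numeral, so numeral arguments
suffice. The rules for the constants of `T_Learn` speak only of these. -/
theorem Computes.of_appNums : (k : ℕ) → {A : Ty B} → {t : Tm C [] (Ty.curry k A)} →
    {f : (Ty.curry k A).den} →
    (∀ n : Fin k → ℕ, Computes R st A (t.appNums n) (Ty.appsD k f n)) →
    Computes R st (Ty.curry k A) t f
  | 0, _, _, _, h => h Fin.elim0
  | k + 1, _, t, _, h => fun _ x hu =>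
    of_eqv (.app (.refl t) hu) (of_appNums k fun n => h (Fin.cons x n))

end Adequacy

/-! ## Models of system T, of `T_Learn` and of `T_Class` -/

def TTm.interp : Interp NoConst := fun _ c => nomatch c

theorem TTm.eval_eq {Γ : List TyT} {A : TyT} {t u : TTm Γ A} (h : TEq t u) (ρ : Env Γ) :
    t.eval TTm.interp ρ = u.eval TTm.interp ρ :=
  Eqv.eval_eq (fun _ _ _ _ h => nomatch h) h ρ

theorem TTm.computes {A : TyT} (t : TTm [] A) :
    Computes noRules (fun e _ => nomatch e) A t (t.eval TTm.interp Env.nil) :=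
  Computes.eval (fun _ c => nomatch c) t

/-- Soundness in one direction, adequacy in the other: truth of a closed boolean term in system T is
decided by its value. -/
theorem TTm.teq_bool (t : TTm [] Ty.bool) {b : Bool} :
    TEq t (bif b then .tt else .ff) ↔ t.eval TTm.interp Env.nil = b := by
  constructor
  · intro h
    rw [TTm.eval_eq h]
    cases b <;> rfl
  · rintro rfl
    exact TTm.computes t

theorem TTm.teq_tt {t : TTm [] Ty.bool} : TEq t .tt ↔ t.eval TTm.interp Env.nil = true :=
  TTm.teq_bool t (b := true)

theorem TTm.teq_ff {t : TTm [] Ty.bool} : TEq t .ff ↔ t.eval TTm.interp Env.nil = false :=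
  TTm.teq_bool t (b := false)

theorem TTm.teq_ff_of_not_teq_tt {t : TTm [] Ty.bool} (h : ¬ TEq t .tt) : TEq t .ff := by
  rw [TTm.teq_tt] at h
  exact TTm.teq_ff.2 (Bool.eq_false_of_not_eq_true h)

/-- The value of a predicate. -/
def Pred.val (P : Pred) : (Ty.curry P.k (Ty.nat ⇒ₜ Ty.bool) : TyT).den :=
  P.tm.eval TTm.interp Env.nil

theorem Pred.eval_at (P : Pred) (n : Fin P.k → ℕ) (m : ℕ) :
    (P.at n m).eval TTm.interp Env.nil = Ty.appsD P.k P.val n m := by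
  have h := Tm.eval_appNums TTm.interp Env.nil P.tm n
  have h' := Tm.eval_numeral (C := NoConst) TTm.interp (Γ := []) m Env.nil
  exact congr h h'

theorem KState.Mem.unique {S : KState} {P : Pred} {n : Fin P.k → ℕ} {m m' : ℕ}
    (h : S.Mem P n m) (h' : S.Mem P n m') : m = m' := by
  obtain ⟨a, ha, hk, rfl⟩ := h
  obtain ⟨b, hb, hk', rfl⟩ := h'
  exact S.consistent a ha b hb (hk.trans hk'.symm)

open Classical in
/-- The value of `φ_P`. -/
noncomputable def KState.witness (S : KState) (P : Pred) (n : Fin P.k → ℕ) : ℕ :=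
  if h : ∃ m, S.Mem P n m then h.choose else 0

open Classical in
/-- The value of `add_P`. -/
noncomputable def KState.update (S : KState) (P : Pred) (n : Fin P.k → ℕ) (m : ℕ) : KState :=
  if h : TEq (P.at n m) .tt ∧ ¬ ∃ l, S.Mem P n l then .singleton ⟨⟨P, n⟩, m, h.1⟩ else .empty

open Classical in
noncomputable def LearnTm.interp : Interp LearnConst
  | _, .st S => S
  | _, .cup => fun S S' : KState => S.cup S'
  | _, .chi P => fun S : KState => Ty.curryD (A := Ty.bool) P.k fun n =>
      decide (∃ m, S.Mem P n m)
  | _, .phi P => fun S : KState => Ty.curryD (A := Ty.nat) P.k fun n => S.witness P n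
  | _, .add P => fun S : KState => Ty.curryD (A := Ty.nat ⇒ₜ TyS.state) P.k fun n (m : ℕ) =>
      S.update P n m

theorem LearnTm.eval_rule (Γ : List TyS) (A : TyS) (t u : LearnTm Γ A) (h : LearnRules Γ A t u)
    (ρ : Env Γ) : t.eval LearnTm.interp ρ = u.eval LearnTm.interp ρ := by
  classical
  cases h with
  | cup => rfl
  | chiTrue P S n m h =>
    refine (Tm.eval_appNums _ _ _ _).trans ((Ty.appsD_curryD _ _ _).trans ?_)
    exact decide_eq_true ⟨m, h⟩
  | chiFalse P S n h =>
    refine (Tm.eval_appNums _ _ _ _).trans ((Ty.appsD_curryD _ _ _).trans ?_)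
    exact decide_eq_false h
  | phiSome P S n m h =>
    refine (Tm.eval_appNums _ _ _ _).trans ((Ty.appsD_curryD _ _ _).trans ?_)
    rw [Tm.eval_numeral]
    have h' : ∃ m, S.Mem P n m := ⟨m, h⟩
    exact (dif_pos h').trans (h'.choose_spec.unique h)
  | phiNone P S n h =>
    refine (Tm.eval_appNums _ _ _ _).trans ((Ty.appsD_curryD _ _ _).trans ?_)
    exact dif_neg h
  | addEmpty P S n m h =>
    refine (congr ((Tm.eval_appNums LearnTm.interp ρ _ n).trans (Ty.appsD_curryD _ _ _))
      (Tm.eval_numeral LearnTm.interp m ρ)).trans (dif_neg ?_)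
    -- The two rules for `add_P` do not overlap: by soundness no term is provably equal to both
    -- truth values.
    rintro ⟨h₁, h₂⟩
    rcases h with h | h
    · exact h₂ h
    · rw [TTm.teq_tt] at h₁
      rw [TTm.teq_ff, h₁] at h
      cases h
  | addNew P S n m h h' =>
    exact (congr ((Tm.eval_appNums LearnTm.interp ρ _ n).trans (Ty.appsD_curryD _ _ _))
      (Tm.eval_numeral LearnTm.interp m ρ)).trans (dif_pos ⟨h, h'⟩)

theorem LearnTm.eval_eq {Γ : List TyS} {A : TyS} {t u : LearnTm Γ A} (h : LearnEq t u)
    (ρ : Env Γ) : t.eval LearnTm.interp ρ = u.eval LearnTm.interp ρ :=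
  Eqv.eval_eq LearnTm.eval_rule h ρ

/-- Computation of values by closed terms of `T_Learn`. -/
abbrev LearnTm.Computes {A : TyS} (t : LearnTm [] A) (x : A.den) : Prop :=
  LearningRealizability.Computes LearnRules (fun _ S => LearnTm.st S) A t x

/-- The rules decide every constant on state constants and numerals, so each constant computes its
intended value. This is the hypothesis of adequacy for `T_Learn`. -/
theorem LearnTm.computes_const (A : TyS) (c : LearnConst A) :
    LearnTm.Computes (.const c) (LearnTm.interp A c) := by
  classical
  cases c with
  | st S => exact .refl _
  | cup =>
    intro u S hu v S' hv
    exact (Eqv.app (.app (.refl _) hu) hv).trans (.contr (.rule (.cup S S')))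
  | chi P =>
    intro u S hu
    refine .of_eqv (.app (.refl _) hu) (.of_appNums _ fun n => .of_eq (Ty.appsD_curryD _ _ _) ?_)
    by_cases h : ∃ m, S.Mem P n m
    · refine .of_eq (decide_eq_true h) ?_
      exact .contr (.rule (.chiTrue P S n _ h.choose_spec))
    · refine .of_eq (decide_eq_false h) ?_
      exact .contr (.rule (.chiFalse P S n h))
  | phi P =>
    intro u S hu
    refine .of_eqv (.app (.refl _) hu) (.of_appNums _ fun n => .of_eq (Ty.appsD_curryD _ _ _) ?_)
    by_cases h : ∃ m, S.Mem P n m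
    · refine .of_eq (dif_pos h) ?_
      exact .contr (.rule (.phiSome P S n _ h.choose_spec))
    · refine .of_eq (dif_neg h) ?_
      exact .contr (.rule (.phiNone P S n h))
  | add P =>
    intro u S hu
    refine .of_eqv (.app (.refl _) hu) (.of_appNums _ fun n => .of_eq (Ty.appsD_curryD _ _ _) ?_)
    intro v m hv
    refine .of_eqv (.app (.refl _) hv) ?_
    by_cases h : TEq (P.at n m) .tt ∧ ¬ ∃ l, S.Mem P n l
    · refine .of_eq (dif_pos h) ?_
      exact .contr (.rule (.addNew P S n m h.1 h.2))
    · refine .of_eq (dif_neg h) ?_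
      refine .contr (.rule (.addEmpty P S n m ?_))
      by_cases h' : ∃ l, KState.Mem S P n l
      · exact .inl h'
      -- The rule asks for provable falsity; failure of provable truth yields it by adequacy of
      -- system T.
      · exact .inr (TTm.teq_ff_of_not_teq_tt fun h₁ => h ⟨h₁, h'⟩)

/-- From here on, equalities with state constants are checked in the model. -/
theorem LearnTm.eq_st {t : LearnTm [] TyS.state} {S : KState} :
    LearnEq t (LearnTm.st S) ↔ t.eval LearnTm.interp Env.nil = S :=
  ⟨fun h => LearnTm.eval_eq h _, fun h => h ▸ Computes.eval LearnTm.computes_const t⟩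

/-- The interpretation of the constants of `T_Class` at the state `S`. -/
noncomputable def ClassTm.interp (S : KState) : Interp ClassConst :=
  fun A c => (ClassConst.approx S [] A c).eval LearnTm.interp Env.nil

theorem ClassTm.eval_approx (S : KState) {Γ : List TyS} {A : TyS} (t : ClassTm Γ A) (ρ : Env Γ) :
    (t.approx S).eval LearnTm.interp ρ = t.eval (ClassTm.interp S) ρ :=
  Tm.eval_mapConst _ _ _ (fun _ _ c _ => by cases c <;> rfl) t ρ

/-! ## System T inside `T_Class` -/

/-- The values of a term of system T and of its embedding into `T_Class`. -/
def Ty.LiftRel : (A : TyT) → A.den → (Ty.lift A).den → Prop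
  | .nat, x, y => x = y
  | .bool, x, y => x = y
  | .atom e, _, _ => nomatch e
  | .prod U V, x, y => Ty.LiftRel U x.1 y.1 ∧ Ty.LiftRel V x.2 y.2
  | .arrow U V, f, g => ∀ x y, Ty.LiftRel U x y → Ty.LiftRel V (f x) (g y)

/-- The types of system T and their lifts have different, though isomorphic, interpretations at
higher types; a logical relation compares them. The interpretation `I` is arbitrary because embedded
terms contain no constants. -/
theorem TTm.liftRel_eval (I : Interp ClassConst) {Γ : List TyT} {A : TyT} (t : TTm Γ A) :
    ∀ (ρ : Env Γ) (ρ' : Env (Γ.map Ty.lift)),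
      (∀ A (v : Var Γ A), Ty.LiftRel A (ρ A v) (ρ' _ (Var.lift v))) →
      Ty.LiftRel A (t.eval TTm.interp ρ) (t.toClass.eval I ρ') := by
  induction t with
  | var v => exact fun ρ ρ' h => h _ v
  | const c => exact nomatch c
  | zero => exact fun ρ ρ' h => rfl
  | tt => exact fun ρ ρ' h => rfl
  | ff => exact fun ρ ρ' h => rfl
  | ite A =>
    rintro ρ ρ' h b _ rfl u u' hu v v' hv
    cases b
    · exact hv
    · exact hu
  | recr A =>
    rintro ρ ρ' h u u' hu v v' hv n _ rfl
    induction n with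
    | zero => exact hu
    | succ n ih => exact hv n n rfl _ _ ih
  | succ t ih => exact fun ρ ρ' h => congrArg Nat.succ (ih ρ ρ' h)
  | app t u iht ihu => exact fun ρ ρ' h => iht ρ ρ' h _ _ (ihu ρ ρ' h)
  | fst t ih => exact fun ρ ρ' h => (ih ρ ρ' h).1
  | snd t ih => exact fun ρ ρ' h => (ih ρ ρ' h).2
  | pair t u iht ihu => exact fun ρ ρ' h => ⟨iht ρ ρ' h, ihu ρ ρ' h⟩
  | lam t ih =>
    intro ρ ρ' h x y hxy
    refine ih _ (Env.cons y ρ') ?_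
    intro A v
    cases v with
    | z => exact hxy
    | s v => exact h _ v

theorem Ty.appsD_cast_lift : (k : ℕ) → (e : Ty.lift (Ty.curry k Ty.bool) = Ty.curry k Ty.bool) →
    (f : (Ty.curry k Ty.bool : TyT).den) → (g : (Ty.lift (Ty.curry k Ty.bool)).den) →
    Ty.LiftRel _ f g → (v : Fin k → ℕ) →
    Ty.appsD (A := Ty.bool) k (cast (congrArg Ty.den e) g) v = Ty.appsD (A := Ty.bool) k f v
  | 0, _, _, _, h, _ => h.symm
  | k + 1, e, f, g, h, v => by
    have e' : Ty.lift (Ty.curry k Ty.bool) = Ty.curry k Ty.bool := Ty.lift_curry k Ty.bool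
    have hc : ∀ {X Y : TyS} (e : X = Y) (e₁ : (Ty.nat ⇒ₜ X) = (Ty.nat ⇒ₜ Y))
        (g : (Ty.nat ⇒ₜ X).den) (n : ℕ),
        (cast (congrArg Ty.den e₁) g : (Ty.nat ⇒ₜ Y).den) n =
          cast (congrArg Ty.den e) (g n) := by
      rintro X _ rfl e₁ g n
      rfl
    have h₁ := Ty.appsD_cast_lift k e' (f (v 0)) (g (v 0)) (h _ _ rfl) fun i => v i.succ
    exact (congrArg (fun x => Ty.appsD (A := Ty.bool) k x fun i => v i.succ)
      (hc e' e g (v 0))).trans h₁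

/-- An atomic formula of system T has no oracle constants, so its value is the same at every state.
This carries truth from an approximation back to system T. -/
theorem AtomicT.eval_class (I : Interp ClassConst) (P : AtomicT) (n m : ℕ) :
    (Tm.apps P.k (TTm.toClassFun P.Q) fun i =>
      Tm.sub (numSub 2 (Fin.cons m (Fin.cons n Fin.elim0))) (TTm.toClass (P.ts i))).eval I Env.nil =
    (P.at (.numeral n) (.numeral m)).eval TTm.interp Env.nil := by
  have hcast : ∀ {X Y : TyS} (e : X = Y) (t : ClassTm [] X),
      (cast (congrArg (ClassTm []) e) t).eval I Env.nil =
        cast (congrArg Ty.den e) (t.eval I Env.nil) := by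
    rintro X _ rfl t
    rfl
  have hts : ∀ i, Tm.eval I (Tm.sub (numSub 2 (Fin.cons m (Fin.cons n Fin.elim0)))
      (TTm.toClass (P.ts i))) Env.nil =
      Tm.eval TTm.interp (Tm.sub (pairSub (.numeral n) (.numeral m)) (P.ts i)) Env.nil := by
    intro i
    rw [Tm.eval_sub]
    refine (Tm.eval_sub I (TTm.toClass (P.ts i)) _ _).trans ?_
    symm
    refine TTm.liftRel_eval I (P.ts i) _ _ ?_
    intro A v
    rcases v with _ | (_ | v)
    · exact (Tm.eval_numeral TTm.interp m _).trans (Tm.eval_numeral I m _).symm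
    · exact (Tm.eval_numeral TTm.interp n _).trans (Tm.eval_numeral I n _).symm
    · cases v
  refine (Tm.eval_apps I _ _ _ _).trans
    (Eq.trans ?_ (Tm.eval_apps TTm.interp Env.nil P.k P.Q fun i =>
      Tm.sub (pairSub (.numeral n) (.numeral m)) (P.ts i)).symm)
  refine (congr (congrArg _ (hcast (Ty.lift_curry P.k Ty.bool) _)) (funext hts)).trans
    (Ty.appsD_cast_lift _ (Ty.lift_curry P.k Ty.bool) _ _ ?_ _)
  exact TTm.liftRel_eval I P.Q _ _ fun _ v => nomatch v

/-! ## Abstraction of the state -/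

def Var.weakRight {B : Type} {Δ : List (Ty B)} : {Γ : List (Ty B)} → {A : Ty B} → Var Γ A →
    Var (Γ ++ Δ) A
  | _, _, .z => .z
  | _, _, .s v => .s (Var.weakRight v)

/-- The state variable is placed outermost, at the end of the context, so that it stays last under
binders and no renaming is needed. -/
def Var.last {B : Type} {U : Ty B} : (Γ : List (Ty B)) → Var (Γ ++ [U]) U
  | [] => .z
  | _ :: Γ => .s (Var.last Γ)

/-- The approximation of a constant at a state given by a variable. -/
def ClassConst.abstract {Γ : List TyS} (v : Var Γ TyS.state) : ∀ A, ClassConst A → LearnTm Γ A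
  | _, .st S => LearnTm.st S
  | _, .cup => .const .cup
  | _, .oracle P => .app (.const (.chi P)) (.var v)
  | _, .skolem P => .app (.const (.phi P)) (.var v)
  | _, .add P => .app (.const (.add P)) (.var v)

/-- The approximation of a term at a state given by an additional variable. -/
def ClassTm.abstract : {Γ : List TyS} → {A : TyS} → ClassTm Γ A → LearnTm (Γ ++ [TyS.state]) A
  | _, _, .var v => .var v.weakRight
  | Γ, _, .const c => ClassConst.abstract (Var.last Γ) _ c
  | _, _, .zero => .zero
  | _, _, .tt => .tt
  | _, _, .ff => .ff
  | _, _, .ite A => .ite A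
  | _, _, .recr A => .recr A
  | _, _, .succ t => .succ (ClassTm.abstract t)
  | _, _, .app t u => .app (ClassTm.abstract t) (ClassTm.abstract u)
  | _, _, .fst t => .fst (ClassTm.abstract t)
  | _, _, .snd t => .snd (ClassTm.abstract t)
  | _, _, .pair t u => .pair (ClassTm.abstract t) (ClassTm.abstract u)
  | _, _, .lam (U := U) (V := V) t =>
    .lam (show LearnTm (U :: (_ ++ [TyS.state])) V from ClassTm.abstract t)

theorem ClassTm.eval_abstract {Γ : List TyS} {A : TyS} (t : ClassTm Γ A) :
    ∀ ρ : Env (Γ ++ [TyS.state]), (ClassTm.abstract t).eval LearnTm.interp ρ =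
      t.eval (ClassTm.interp (ρ _ (Var.last Γ))) fun _ v => ρ _ v.weakRight := by
  induction t with
  | const c => intro ρ; cases c <;> rfl
  | succ t ih => exact fun ρ => congrArg Nat.succ (ih ρ)
  | app t u iht ihu => exact fun ρ => congr (iht ρ) (ihu ρ)
  | fst t ih => exact fun ρ => congrArg Prod.fst (ih ρ)
  | snd t ih => exact fun ρ => congrArg Prod.snd (ih ρ)
  | pair t u iht ihu => exact fun ρ => congr (congrArg Prod.mk (iht ρ)) (ihu ρ)
  | lam t ih =>
    intro ρ
    funext x
    refine (ih (Env.cons x ρ)).trans (congrArg (Tm.eval _ t) ?_)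
    funext A v
    cases v <;> rfl
  | _ => intros; rfl

/-! ## Translation into system T

A term of base type is translated into a pair: its value as a function of the state, and a modulus
of convergence, which for a sequence `σ` of states, a function `h` and a number `a` yields some
`m ≥ a` such that the value at `σ i` is the same for all `i` from `m` to `h m`. A state is
represented by the function mapping the code of `⟨P, n⟩` to `m + 1` if `⟨P, n, m⟩` is in the state,
and to `0` if there is no such `m`. -/

section Translation

local notation "x₀" => Tm.var Var.z
local notation "x₁" => Tm.var (Var.s Var.z)
local notation "x₂" => Tm.var (Var.s (Var.s Var.z))
local notation "x₃" => Tm.var (Var.s (Var.s (Var.s Var.z)))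
local notation "x₄" => Tm.var (Var.s (Var.s (Var.s (Var.s Var.z))))
local notation "x₅" => Tm.var (Var.s (Var.s (Var.s (Var.s (Var.s Var.z)))))
local notation "x₆" => Tm.var (Var.s (Var.s (Var.s (Var.s (Var.s (Var.s Var.z))))))
local infixl:70 " ⬝ " => Tm.app

/-- The type of representations of states. -/
abbrev Ty.rep {B : Type} : Ty B := .nat ⇒ₜ .nat

/-- The type of convergent families of objects of type `X`. -/
abbrev Ty.conv {B : Type} (X : Ty B) : Ty B :=
  .prod (Ty.rep ⇒ₜ X) ((Ty.nat ⇒ₜ Ty.rep) ⇒ₜ (Ty.nat ⇒ₜ Ty.nat) ⇒ₜ Ty.nat ⇒ₜ Ty.nat)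

/-- Translation of types. -/
def Ty.star {B B' : Type} : Ty B → Ty B'
  | .nat => Ty.conv .nat
  | .bool => Ty.conv .nat
  | .atom _ => Ty.conv Ty.rep
  | .prod U V => .prod (Ty.star U) (Ty.star V)
  | .arrow U V => .arrow (Ty.star U) (Ty.star V)

def Var.star {B B' : Type} : {Γ : List (Ty B)} → {A : Ty B} → Var Γ A →
    Var (Γ.map (Ty.star (B' := B'))) (Ty.star A)
  | _, _, .z => .z
  | _, _, .s v => .s (Var.star v)

namespace Tm

variable {B B' : Type} {C : Ty B → Type} {C' : Ty B' → Type} {Γ : List (Ty B')}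

/-- A closed term in a context. -/
def weak {A : Ty B'} (t : Tm C' [] A) : Tm C' Γ A := ren (fun _ (v : Var [] _) => nomatch v) t

theorem eval_weak (I : Interp C') {A : Ty B'} (t : Tm C' [] A) (ρ : Env Γ) :
    (weak t : Tm C' Γ A).eval I ρ = t.eval I Env.nil :=
  (eval_ren I t _ ρ).trans (congrArg _ (Env.eq_nil _))

/-- `λ x n. 2 ^ x * (2 * n + 1)`. -/
def pairing : Tm C' Γ (Ty.nat ⇒ₜ Ty.nat ⇒ₜ Ty.nat) :=
  .lam (.lam (.recr .nat
    -- The base value is 2n + 1; the step doubles it x times.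
    ⬝ .succ (.recr .nat ⬝ .zero ⬝ .lam (.lam (.succ (.succ x₀))) ⬝ x₀)
    ⬝ .lam (.lam (.recr .nat ⬝ .zero ⬝ .lam (.lam (.succ (.succ x₀))) ⬝ x₀)) ⬝ x₁))

/-- The representation of the state with a single atom. -/
def singleRep : Tm C' Γ (Ty.nat ⇒ₜ Ty.nat ⇒ₜ Ty.rep) :=
  .lam (.lam (.recr Ty.rep
    ⬝ .lam (.recr .nat ⬝ .succ x₁ ⬝ .lam (.lam .zero) ⬝ x₀)
    -- Increasing the key by one shifts the function one place to the right, with value 0 at 0.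
    ⬝ .lam (.lam (.lam (.recr .nat ⬝ .zero ⬝ .lam (.lam (x₃ ⬝ x₁)) ⬝ x₀))) ⬝ x₁))

/-- Consistent union of representations of states. -/
def cupRep : Tm C' Γ (Ty.rep ⇒ₜ Ty.rep ⇒ₜ Ty.rep) :=
  -- The recursor is used as a zero test: a positive entry of the first state is kept, otherwise the
  -- second state is consulted.
  .lam (.lam (.lam (.recr .nat ⬝ (x₁ ⬝ x₀) ⬝ .lam (.lam (.succ x₁)) ⬝ (x₂ ⬝ x₀))))

/-- The constant family. -/
def convConst (X : Ty B') : Tm C' Γ (X ⇒ₜ Ty.conv X) :=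
  .lam (.pair (.lam x₁) (.lam (.lam (.lam x₀))))

/-- The value of the state at a given code. -/
def convLookup : Tm C' Γ (Ty.nat ⇒ₜ Ty.conv .nat) :=
  .lam (.pair (.lam (x₀ ⬝ x₁))
    -- The entry is tested in the state σ (h a): if it is 0 the modulus returns a, otherwise h a.
    (.lam (.lam (.lam (.recr .nat ⬝ x₀ ⬝ .lam (.lam (x₃ ⬝ x₂)) ⬝ (x₂ ⬝ (x₁ ⬝ x₀) ⬝ x₃))))))

/-- Composition of a convergent family of numbers with a sequence of convergent families. -/
def convBind (X : Ty B') :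
    Tm C' Γ (Ty.conv .nat ⇒ₜ (Ty.nat ⇒ₜ Ty.conv X) ⇒ₜ Ty.conv X) :=
  .lam (.lam (.pair (.lam (.fst (x₁ ⬝ (.fst x₂ ⬝ x₀)) ⬝ x₀))
    (.lam (.lam (.lam
      -- With g j the modulus of the inner family selected at σ j, started from j, the outer modulus
      -- is taken for h ∘ g. If it returns m, the answer is g m.
      (.lam (x₀ ⬝ (.snd x₅ ⬝ x₃ ⬝ .lam (x₃ ⬝ (x₁ ⬝ x₀)) ⬝ x₁))
        ⬝ .lam (.snd (x₄ ⬝ (.fst x₅ ⬝ (x₃ ⬝ x₀))) ⬝ x₃ ⬝ x₂ ⬝ x₀)))))))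

/-- Consistent union of convergent families of states. -/
def convCup : Tm C' Γ (Ty.conv Ty.rep ⇒ₜ Ty.conv Ty.rep ⇒ₜ Ty.conv Ty.rep) :=
  .lam (.lam (.pair (.lam (cupRep ⬝ (.fst x₂ ⬝ x₀) ⬝ (.fst x₁ ⬝ x₀)))
    (.lam (.lam (.lam
      (.lam (x₀ ⬝ (.snd x₅ ⬝ x₃ ⬝ .lam (x₃ ⬝ (x₁ ⬝ x₀)) ⬝ x₁))
        ⬝ .lam (.snd x₄ ⬝ x₃ ⬝ x₂ ⬝ x₀)))))))

def convSucc : Tm C' Γ (Ty.conv .nat ⇒ₜ Ty.conv .nat) :=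
  .lam (convBind .nat ⬝ x₀ ⬝ .lam (convConst .nat ⬝ .succ x₀))

def convPairing : Tm C' Γ (Ty.conv .nat ⇒ₜ Ty.conv .nat ⇒ₜ Ty.conv .nat) :=
  .lam (.lam (convBind .nat ⬝ x₁ ⬝ .lam (convBind .nat ⬝ x₁
    ⬝ .lam (convConst .nat ⬝ (pairing ⬝ x₁ ⬝ x₀)))))

/-- Composition of a convergent family of numbers with a sequence of objects of a translated
type. -/
def bind : {Γ : List (Ty B')} → (A : Ty B) →
    Tm C' Γ (Ty.conv .nat ⇒ₜ (Ty.nat ⇒ₜ Ty.star A) ⇒ₜ Ty.star A)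
  | _, .nat => convBind .nat
  | _, .bool => convBind .nat
  | _, .atom _ => convBind Ty.rep
  | _, .prod U V => .lam (.lam (.pair (bind U ⬝ x₁ ⬝ .lam (.fst (x₁ ⬝ x₀)))
      (bind V ⬝ x₁ ⬝ .lam (.snd (x₁ ⬝ x₀)))))
  | _, .arrow _ V => .lam (.lam (.lam (bind V ⬝ x₂ ⬝ .lam (x₂ ⬝ x₀ ⬝ x₁))))

/-- A boolean depends on the state while the branches may have any type, so the case distinction is
carried through `bind`. The code 0 stands for True, and other codes select the second branch. -/
def starIte (A : Ty B) :
    Tm C' Γ (Ty.conv .nat ⇒ₜ Ty.star A ⇒ₜ Ty.star A ⇒ₜ Ty.star A) :=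
  .lam (.lam (.lam (bind A ⬝ x₂ ⬝ .lam (.recr (Ty.star A) ⬝ x₂ ⬝ .lam (.lam x₃) ⬝ x₀))))

/-- For a number independent of the state this is ordinary recursion, with constant families as
indices; `bind` extends it to a number that depends on the state. -/
def starRec (A : Ty B) :
    Tm C' Γ (Ty.star A ⇒ₜ (Ty.conv .nat ⇒ₜ Ty.star A ⇒ₜ Ty.star A) ⇒ₜ
      Ty.conv .nat ⇒ₜ Ty.star A) :=
  .lam (.lam (.lam (bind A ⬝ x₀ ⬝ .lam (.recr (Ty.star A) ⬝ x₃
    ⬝ .lam (.lam (x₄ ⬝ (convConst .nat ⬝ x₁) ⬝ x₀)) ⬝ x₀))))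

/-- Translation of terms, given the translations of the constants. -/
def star (c' : ∀ A, C A → Tm C' [] (Ty.star A)) : {Γ : List (Ty B)} → {A : Ty B} →
    Tm C Γ A → Tm C' (Γ.map Ty.star) (Ty.star A)
  | _, _, .var v => .var v.star
  | _, _, .const c => weak (c' _ c)
  | _, _, .zero => convConst .nat ⬝ .zero
  | _, _, .tt => convConst .nat ⬝ .zero
  | _, _, .ff => convConst .nat ⬝ .succ .zero
  | _, _, .ite A => starIte A
  | _, _, .recr A => starRec A
  | _, _, .succ t => convSucc ⬝ star c' t
  | _, _, .app t u => star c' t ⬝ star c' u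
  | _, _, .fst t => .fst (star c' t)
  | _, _, .snd t => .snd (star c' t)
  | _, _, .pair t u => .pair (star c' t) (star c' u)
  | _, _, .lam t => .lam (star c' t)

/-- The translations of the arguments of a function of a predicate, a vector and further
arguments: `D` receives the number `p`, the predicate applied to the vector, and the code of the
vector. -/
def starCurry (A : Ty B)
    (D : ∀ Γ, Tm C' Γ (Ty.nat ⇒ₜ (Ty.conv .nat ⇒ₜ Ty.conv .nat) ⇒ₜ Ty.conv .nat ⇒ₜ Ty.star A))
    (p : ℕ) : {Γ : List (Ty B')} → (k : ℕ) →
    Tm C' Γ (Ty.star (Ty.curry k (Ty.nat ⇒ₜ Ty.bool) : TyT) ⇒ₜ Ty.conv .nat ⇒ₜ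
      Ty.star (Ty.curry k A))
  | _, 0 => D _ ⬝ numeral p
  | _, k + 1 => .lam (.lam (.lam (starCurry A D p k ⬝ (x₂ ⬝ x₀) ⬝ (convPairing ⬝ x₁ ⬝ x₀))))

/-- A positive entry at the key means that a witness is known; since 0 codes True, the result is 0
in this case and 1 otherwise. -/
def starOracle :
    Tm C' Γ (Ty.nat ⇒ₜ (Ty.conv .nat ⇒ₜ Ty.conv .nat) ⇒ₜ Ty.conv .nat ⇒ₜ Ty.conv .nat) :=
  .lam (.lam (.lam (convBind .nat ⬝ x₀ ⬝ .lam (convBind .nat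
    ⬝ (convLookup ⬝ (pairing ⬝ x₀ ⬝ x₃))
    ⬝ .lam (convConst .nat ⬝ (.recr .nat ⬝ .succ .zero ⬝ .lam (.lam .zero) ⬝ x₀))))))

/-- Entries are witnesses plus one, so the predecessor returns the witness, and the default 0 when
there is none. -/
def starSkolem :
    Tm C' Γ (Ty.nat ⇒ₜ (Ty.conv .nat ⇒ₜ Ty.conv .nat) ⇒ₜ Ty.conv .nat ⇒ₜ Ty.conv .nat) :=
  .lam (.lam (.lam (convBind .nat ⬝ x₀ ⬝ .lam (convBind .nat
    ⬝ (convLookup ⬝ (pairing ⬝ x₀ ⬝ x₃))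
    ⬝ .lam (convConst .nat ⬝ (.recr .nat ⬝ .zero ⬝ .lam (.lam x₁) ⬝ x₀))))))

/-- The truth value of the atom comes from the translated predicate itself. The two nested zero
tests return the empty state if the key is already known or the predicate is False, and the new atom
otherwise. -/
def starAdd :
    Tm C' Γ (Ty.nat ⇒ₜ (Ty.conv .nat ⇒ₜ Ty.conv .nat) ⇒ₜ Ty.conv .nat ⇒ₜ
      Ty.conv .nat ⇒ₜ Ty.conv Ty.rep) :=
  .lam (.lam (.lam (.lam (convBind Ty.rep ⬝ (x₂ ⬝ x₀) ⬝ .lam (convBind Ty.rep ⬝ x₁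
    ⬝ .lam (convBind Ty.rep ⬝ x₃ ⬝ .lam (convBind Ty.rep
      ⬝ (convLookup ⬝ (pairing ⬝ x₀ ⬝ x₆))
      ⬝ .lam (convConst Ty.rep ⬝ .lam (.recr .nat
        ⬝ (.recr .nat ⬝ (singleRep ⬝ (pairing ⬝ x₂ ⬝ .var (.s (.s (.s (.s (.s (.s (.s (.s .z)))))))))
            ⬝ x₃ ⬝ x₀) ⬝ .lam (.lam .zero) ⬝ x₄)
        ⬝ .lam (.lam .zero) ⬝ x₁)))))))))

end Tm

/-- Translation of the constants of `T_Class`; a state constant is read as `∅`. -/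
def ClassConst.star {B' : Type} {C' : Ty B' → Type} : ∀ A, ClassConst A → Tm C' [] (Ty.star A)
  | _, .st _ => .convConst Ty.rep ⬝ .lam .zero
  | _, .cup => .convCup
  | _, .oracle P => .starCurry Ty.bool (fun _ => .starOracle) P.code P.k
      ⬝ .star (fun _ c => nomatch c) P.tm ⬝ (.convConst .nat ⬝ .zero)
  | _, .skolem P => .starCurry Ty.nat (fun _ => .starSkolem) P.code P.k
      ⬝ .star (fun _ c => nomatch c) P.tm ⬝ (.convConst .nat ⬝ .zero)
  | _, .add P => .starCurry (Ty.nat ⇒ₜ TyS.state) (fun _ => .starAdd) P.code P.k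
      ⬝ .star (fun _ c => nomatch c) P.tm ⬝ (.convConst .nat ⬝ .zero)

namespace Tm

variable {B' : Type} {C' : Ty B' → Type} {Γ : List (Ty B')}

/-- The sequence of states `∅, …, S, S ⋓ t[S], …` for a convergent family `t` of states. -/
def learning : Tm C' Γ (Ty.conv Ty.rep ⇒ₜ Ty.nat ⇒ₜ Ty.rep) :=
  .lam (.recr Ty.rep ⬝ .lam .zero ⬝ .lam (.lam (cupRep ⬝ x₀ ⬝ (.fst x₂ ⬝ x₀))))

/-- An index at which the sequence of states is stationary. -/
def stationary : Tm C' Γ (Ty.conv Ty.rep ⇒ₜ Ty.nat) :=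
  .lam (.snd x₀ ⬝ (learning ⬝ x₀) ⬝ .lam (.succ x₀) ⬝ .zero)

/-- The number of learning steps for a realizer `Nat → S`. -/
def learningSteps : Tm C' Γ ((Ty.conv .nat ⇒ₜ Ty.conv Ty.rep) ⇒ₜ Ty.nat ⇒ₜ Ty.nat) :=
  .lam (.lam (stationary ⬝ (x₁ ⬝ (convConst .nat ⬝ x₀))))

/-- The program extracted from a realizer `Nat → Nat × S`. -/
def extract :
    Tm C' Γ ((Ty.conv .nat ⇒ₜ .prod (Ty.conv .nat) (Ty.conv Ty.rep)) ⇒ₜ Ty.nat ⇒ₜ Ty.nat) :=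
  .lam (.lam (.lam (.fst (.fst x₀) ⬝ (learning ⬝ .snd x₀ ⬝ (stationary ⬝ .snd x₀)))
    ⬝ (x₁ ⬝ (convConst .nat ⬝ x₀))))

end Tm

end Translation

/-! ## Injectivity of Gödel numbers -/

theorem Ty.code_injective {B : Type} {cB : B → ℕ} (hB : Function.Injective cB) :
    Function.Injective (Ty.code cB) := by
  intro U
  induction U with
  | atom b =>
    intro V h
    cases V <;> simp only [Ty.code, Nat.pair_eq_pair] at h <;> try omega
    rw [hB h.2]
  | prod U V ihU ihV =>
    intro W h
    cases W <;> simp only [Ty.code, Nat.pair_eq_pair] at h <;> try omega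
    rw [ihU h.2.1, ihV h.2.2]
  | arrow U V ihU ihV =>
    intro W h
    cases W <;> simp only [Ty.code, Nat.pair_eq_pair] at h <;> try omega
    rw [ihU h.2.1, ihV h.2.2]
  | _ =>
    intro V h
    cases V <;> simp only [Ty.code, Nat.pair_eq_pair] at h <;> first | rfl | omega

theorem Var.index_injective {B : Type} {Γ : List (Ty B)} {A : Ty B} (v w : Var Γ A)
    (h : v.index = w.index) : v = w := by
  induction v with
  | z => cases w with
    | z => rfl
    | s w => simp [Var.index] at h
  | s v ih => cases w with
    | z => simp [Var.index] at h
    | s w => rw [ih w (by simpa [Var.index] using h)]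

/-- Codes of applications and projections record the one type that the type of the whole term does
not determine. Recovering it first makes the subterms comparable. -/
theorem Tm.code_injective {B : Type} {C : Ty B → Type} {cB : B → ℕ} {cC : ∀ A, C A → ℕ}
    (hB : Function.Injective cB) (hC : ∀ A, Function.Injective (cC A)) {Γ : List (Ty B)} {A : Ty B}
    (t : Tm C Γ A) : ∀ u : Tm C Γ A, t.code cB cC = u.code cB cC → t = u := by
  have hT := Ty.code_injective hB
  induction t with
  | var v =>
    intro u h
    cases u <;> simp only [Tm.code, Nat.pair_eq_pair] at h <;> try omega
    rw [Var.index_injective _ _ h.2]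
  | const c =>
    intro u h
    cases u <;> simp only [Tm.code, Nat.pair_eq_pair] at h <;> try omega
    rw [hC _ h.2]
  | succ t ih =>
    intro u h
    cases u <;> simp only [Tm.code, Nat.pair_eq_pair] at h <;> try omega
    rw [ih _ h.2]
  | lam t ih =>
    intro u h
    cases u <;> simp only [Tm.code, Nat.pair_eq_pair] at h <;> try omega
    rw [ih _ h.2.2]
  | pair t u iht ihu =>
    intro u h
    cases u <;> simp only [Tm.code, Nat.pair_eq_pair] at h <;> try omega
    rw [iht _ h.2.1, ihu _ h.2.2]
  | app t u iht ihu =>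
    intro u h
    cases u <;> simp only [Tm.code, Nat.pair_eq_pair] at h <;> try omega
    obtain ⟨-, hU, h₁, h₂⟩ := h
    cases hT hU
    rw [iht _ h₁, ihu _ h₂]
  | fst t ih =>
    intro u h
    cases u <;> simp only [Tm.code, Nat.pair_eq_pair] at h <;> try omega
    obtain ⟨-, hU, h₁⟩ := h
    cases hT hU
    rw [ih _ h₁]
  | snd t ih =>
    intro u h
    cases u <;> simp only [Tm.code, Nat.pair_eq_pair] at h <;> try omega
    obtain ⟨-, hU, h₁⟩ := h
    cases hT hU
    rw [ih _ h₁]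
  | _ =>
    intro u h
    cases u <;> simp only [Tm.code, Nat.pair_eq_pair] at h <;> first | rfl | omega

theorem Pred.code_injective : Function.Injective Pred.code := by
  rintro ⟨k, t, ht⟩ ⟨k', t', ht'⟩ h
  obtain ⟨hk, h⟩ := Nat.pair_eq_pair.1 h
  cases hk
  cases Tm.code_injective (fun e => nomatch e) (fun _ c => nomatch c) t t' h
  rfl

/-! ## Representation of states by functions -/

def doubleD (n : ℕ) : ℕ := Nat.rec 0 (fun _ r => Nat.succ (Nat.succ r)) n

/-- The value of `Tm.pairing`. -/
def pairingD (m n : ℕ) : ℕ := Nat.rec (Nat.succ (doubleD n)) (fun _ r => doubleD r) m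

theorem doubleD_eq (n : ℕ) : doubleD n = 2 * n := by
  induction n with
  | zero => rfl
  | succ n ih => exact (congrArg (fun x => Nat.succ (Nat.succ x)) ih).trans (by omega)

theorem pairingD_zero (n : ℕ) : pairingD 0 n = 2 * n + 1 :=
  congrArg Nat.succ (doubleD_eq n)

theorem pairingD_succ (m n : ℕ) : pairingD (m + 1) n = 2 * pairingD m n :=
  doubleD_eq _

/-- The number is 2 ^ m * (2 * n + 1), so parity decides whether m is zero, and halving reduces m by
one. -/
theorem pairingD_injective {m n m' n' : ℕ} (h : pairingD m n = pairingD m' n') :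
    m = m' ∧ n = n' := by
  induction m generalizing m' with
  | zero => cases m' with
    | zero => simp only [pairingD_zero] at h; omega
    | succ m' => simp only [pairingD_zero, pairingD_succ] at h; omega
  | succ m ih => cases m' with
    | zero => simp only [pairingD_zero, pairingD_succ] at h; omega
    | succ m' =>
      simp only [pairingD_succ] at h
      have := @ih m' (by omega)
      omega

/-- The code of a vector with a given initial value. -/
def vecCode : ℕ → (k : ℕ) → (Fin k → ℕ) → ℕ
  | c, 0, _ => c
  | c, k + 1, n => vecCode (pairingD c (n 0)) k fun i => n i.succ

theorem vecCode_injective : (k : ℕ) → {c c' : ℕ} → {n n' : Fin k → ℕ} →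
    vecCode c k n = vecCode c' k n' → c = c' ∧ n = n'
  | 0, _, _, _, _, h => ⟨h, Subsingleton.elim _ _⟩
  | k + 1, _, _, n, n', h => by
    obtain ⟨h₁, h₂⟩ := vecCode_injective k h
    obtain ⟨h₀, h₁⟩ := pairingD_injective h₁
    refine ⟨h₀, ?_⟩
    rw [← Fin.cons_self_tail n, ← Fin.cons_self_tail n', h₁]
    exact congrArg _ h₂

/-- The code of a pair `⟨P, n⟩`. -/
def keyCode (P : Pred) (n : Fin P.k → ℕ) : ℕ := pairingD (vecCode 0 P.k n) P.code

/-- The predicate is recovered first; this fixes the length of the vector, without which its code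
would be ambiguous. -/
theorem keyCode_injective {x y : (P : Pred) × (Fin P.k → ℕ)}
    (h : keyCode x.1 x.2 = keyCode y.1 y.2) : x = y := by
  obtain ⟨P, n⟩ := x
  obtain ⟨P', n'⟩ := y
  obtain ⟨h₁, h₂⟩ := pairingD_injective h
  cases Pred.code_injective h₂
  cases (vecCode_injective _ h₁).2
  rfl

/-- The value of `Tm.singleRep`. -/
def singleD (k m : ℕ) : ℕ → ℕ :=
  Nat.rec (motive := fun _ => ℕ → ℕ) (fun x => Nat.rec (Nat.succ m) (fun _ _ => 0) x)
    (fun _ r x => Nat.rec 0 (fun i _ => r i) x) k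

theorem singleD_eq (k m x : ℕ) : singleD k m x = if x = k then m + 1 else 0 := by
  induction k generalizing x with
  | zero => cases x <;> rfl
  | succ k ih => cases x with
    | zero => rfl
    | succ x => exact (ih x).trans (by simp)

namespace KState

open Classical in
/-- The representation of a state by a function on codes. -/
noncomputable def rep (S : KState) (x : ℕ) : ℕ :=
  if h : ∃ a ∈ S.carrier, keyCode a.key.1 a.key.2 = x then h.choose.wit + 1 else 0

theorem rep_of_mem {S : KState} {a : Atom} (h : a ∈ S.carrier) :
    S.rep (keyCode a.key.1 a.key.2) = a.wit + 1 := by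
  have h' : ∃ b ∈ S.carrier, keyCode b.key.1 b.key.2 = keyCode a.key.1 a.key.2 := ⟨a, h, rfl⟩
  rw [rep, dif_pos h', S.consistent _ h'.choose_spec.1 _ h (keyCode_injective h'.choose_spec.2)]

theorem exists_of_rep_ne_zero {S : KState} {x : ℕ} (h : S.rep x ≠ 0) :
    ∃ a ∈ S.carrier, keyCode a.key.1 a.key.2 = x := by
  by_contra h'
  exact h (dif_neg h')

theorem rep_eq_zero {S : KState} {x : ℕ}
    (h : ∀ a ∈ S.carrier, keyCode a.key.1 a.key.2 ≠ x) : S.rep x = 0 :=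
  dif_neg fun ⟨a, ha, h'⟩ => h a ha h'

/-- An entry, once present, never changes as the state grows. This monotonicity is the source of all
convergence below. -/
theorem rep_eq_of_subset {S S' : KState} (h : S.carrier ⊆ S'.carrier) {x : ℕ}
    (hx : S.rep x ≠ 0) : S'.rep x = S.rep x := by
  obtain ⟨a, ha, rfl⟩ := exists_of_rep_ne_zero hx
  rw [rep_of_mem ha, rep_of_mem (h ha)]

theorem mem_of_rep_eq {S S' : KState} (h : S.rep = S'.rep) {a : Atom} (ha : a ∈ S.carrier) :
    a ∈ S'.carrier := by
  have h₁ := rep_of_mem ha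
  obtain ⟨b, hb, hab⟩ := exists_of_rep_ne_zero (S := S') (x := keyCode a.key.1 a.key.2)
    (by rw [← h, h₁]; exact Nat.succ_ne_zero _)
  have h₂ := rep_of_mem hb
  rw [hab, ← h, h₁, Nat.add_right_cancel_iff] at h₂
  have hkey := keyCode_injective hab
  cases a
  cases b
  cases hkey
  cases h₂
  exact hb

theorem ext {S S' : KState} (h : S.carrier = S'.carrier) : S = S' := by
  cases S
  cases S'
  cases h
  rfl

theorem rep_injective : Function.Injective rep := fun _ _ h =>
  ext (Set.Subset.antisymm (fun _ ha => mem_of_rep_eq h ha) fun _ ha => mem_of_rep_eq h.symm ha)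

theorem rep_empty (x : ℕ) : empty.rep x = 0 :=
  rep_eq_zero fun _ h => absurd h (Set.notMem_empty _)

theorem rep_singleton (a : Atom) (x : ℕ) :
    (singleton a).rep x = singleD (keyCode a.key.1 a.key.2) a.wit x := by
  rw [singleD_eq]
  split_ifs with h
  · rw [h]
    exact rep_of_mem (Set.mem_singleton a)
  · refine rep_eq_zero fun b hb => ?_
    rw [Set.mem_singleton_iff.1 hb]
    exact Ne.symm h

/-- At a key known to the first state, an atom of the second is either discarded or agrees with the
one there; at any other key the second state is unaffected. So consistent union acts entrywise. -/
theorem rep_cup (S S' : KState) (x : ℕ) :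
    (S.cup S').rep x = Nat.rec (S'.rep x) (fun i _ => Nat.succ i) (S.rep x) := by
  cases hx : S.rep x with
  | succ m =>
    refine (rep_eq_of_subset (S := S) Set.subset_union_left ?_).trans hx
    rw [hx]
    exact Nat.succ_ne_zero m
  | zero =>
    have hS : ∀ a ∈ S.carrier, keyCode a.key.1 a.key.2 ≠ x := by
      rintro a ha rfl
      rw [rep_of_mem ha] at hx
      cases hx
    by_cases hx' : S'.rep x = 0
    · refine (rep_eq_zero ?_).trans hx'.symm
      rintro a (ha | ha) h
      · exact hS a ha h
      · cases h
        rw [rep_of_mem ha.1] at hx'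
        cases hx'
    · obtain ⟨a, ha, rfl⟩ := exists_of_rep_ne_zero hx'
      have h : a ∈ (S.cup S').carrier :=
        Or.inr ⟨ha, fun b hb e => absurd (by rw [e]) (hS b hb)⟩
      exact (rep_of_mem h).trans (rep_of_mem ha).symm

theorem rep_eq_succ {S : KState} {P : Pred} {n : Fin P.k → ℕ} {m : ℕ} (h : S.Mem P n m) :
    S.rep (keyCode P n) = m + 1 := by
  obtain ⟨⟨_, _, _⟩, ha, rfl, rfl⟩ := h
  exact rep_of_mem ha

theorem rep_eq_zero_of_not_exists {S : KState} {P : Pred} {n : Fin P.k → ℕ}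
    (h : ¬ ∃ m, S.Mem P n m) : S.rep (keyCode P n) = 0 :=
  rep_eq_zero fun a ha e => h ⟨a.wit, a, ha, keyCode_injective (y := ⟨P, n⟩) e, rfl⟩

end KState

/-! ## Convergence -/

section Convergence

variable {B' : Type} {C' : Ty B' → Type} {Γ : List (Ty B')}

/-- `k` represents the family `V`, and its second component is a modulus of convergence. -/
def Converges {X : Ty B'} (k : (Ty.conv X).den) (V : KState → X.den) : Prop :=
  (∀ S : KState, k.1 S.rep = V S) ∧
    ∀ s : ℕ → KState, (∀ i j, i ≤ j → (s i).carrier ⊆ (s j).carrier) →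
      ∀ h : ℕ → ℕ, (∀ i, i ≤ h i) → ∀ a : ℕ,
        ∃ m : ℕ, m = k.2 (fun i : ℕ => (s i).rep) h a ∧ a ≤ m ∧
          ∀ i, m ≤ i → i ≤ h m → V (s i) = V (s m)

theorem Converges.const (I : Interp C') (ρ : Env Γ) {X : Ty B'} (x : X.den) :
    Converges (X := X) ((Tm.convConst X).eval I ρ x) fun _ => x :=
  ⟨fun _ => rfl, fun _ _ _ _ a => ⟨a, rfl, le_refl a, fun _ _ _ => rfl⟩⟩

/-- By monotonicity one test at h a suffices: an entry zero there is zero on all of [a, h a], and an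
entry positive there is constant from h a on. -/
theorem Converges.lookup (I : Interp C') (ρ : Env Γ) (x : ℕ) :
    Converges (X := .nat) (Tm.convLookup.eval I ρ x) fun S => S.rep x := by
  refine ⟨fun _ => rfl, fun s hs h hh a => ?_⟩
  have e : (Tm.convLookup.eval I ρ x).2 (fun i : ℕ => (s i).rep) h a =
      (Nat.rec a (fun _ _ => h a) ((s (h a)).rep x) : ℕ) := rfl
  cases hx : (s (h a)).rep x with
  | zero =>
    have hz : ∀ i, i ≤ h a → (s i).rep x = 0 := by
      intro i hi
      by_contra hne
      exact hne ((KState.rep_eq_of_subset (hs i _ hi) hne).symm.trans hx)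
    exact ⟨a, by rw [e, hx]; rfl, le_refl a, fun i _ hi => (hz i hi).trans (hz a (hh a)).symm⟩
  | succ m =>
    have hne : (s (h a)).rep x ≠ 0 := by rw [hx]; exact Nat.succ_ne_zero m
    exact ⟨h a, by rw [e, hx], hh a, fun i hi _ => KState.rep_eq_of_subset (hs _ i hi) hne⟩

/-- The outer number is frozen on [m, h (g m)], and on the subinterval from g m on the inner family
selected at s m is frozen too. -/
theorem Converges.bind (I : Interp C') (ρ : Env Γ) {X : Ty B'} {k : (Ty.conv Ty.nat : Ty B').den}
    {V : KState → ℕ} {f : ℕ → (Ty.conv X).den} {F : ℕ → KState → X.den}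
    (hk : Converges (X := .nat) k V) (hf : ∀ n, Converges (f n) (F n)) :
    Converges (X := X) ((Tm.convBind X).eval I ρ k f) fun S => F (V S) S := by
  refine ⟨fun S => ?_, fun s hs h hh a => ?_⟩
  · exact ((hf _).1 S).trans (congrArg (fun n => F n S) (hk.1 S))
  -- The inner modulus, for the family selected by the outer value at s j and started from j, whence
  -- j ≤ g j.
  · let g : ℕ → ℕ := fun j => (f (k.1 (s j).rep)).2 (fun i : ℕ => (s i).rep) h j
    have hg : ∀ j, j ≤ g j ∧
        ∀ i, g j ≤ i → i ≤ h (g j) → F (V (s j)) (s i) = F (V (s j)) (s (g j)) := by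
      intro j
      obtain ⟨m, em, hjm, hm⟩ := (hf (k.1 (s j).rep)).2 s hs h hh j
      have em : m = g j := em
      subst em
      have e : k.1 (s j).rep = V (s j) := hk.1 (s j)
      exact ⟨hjm, fun i hi hi' => e ▸ hm i hi hi'⟩
    obtain ⟨m, em, ham, hm⟩ :=
      hk.2 s hs (fun j => h (g j)) (fun j => (hg j).1.trans (hh _)) a
    refine ⟨g m, congrArg g em, ham.trans (hg m).1, fun i hi hi' => ?_⟩
    -- Both i and g m lie in [m, h (g m)], where the outer value is constant.
    have h₁ : V (s i) = V (s m) := hm i ((hg m).1.trans hi) hi'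
    have h₂ : V (s (g m)) = V (s m) := hm _ (hg m).1 (hh _)
    exact (congrArg (fun n => F n (s i)) h₁).trans (((hg m).2 i hi hi').trans
      (congrArg (fun n => F n (s (g m))) h₂.symm))

theorem Converges.succ (I : Interp C') (ρ : Env Γ) {k : (Ty.conv Ty.nat : Ty B').den}
    {V : KState → ℕ} (hk : Converges (X := .nat) k V) :
    Converges (X := .nat) (Tm.convSucc.eval I ρ k) fun S => Nat.succ (V S) :=
  Converges.bind (X := .nat) I _ (F := fun n _ => Nat.succ n) hk fun n => Converges.const (X := .nat) I _ (Nat.succ n)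

theorem Converges.pairing (I : Interp C') (ρ : Env Γ) {k l : (Ty.conv Ty.nat : Ty B').den}
    {V W : KState → ℕ} (hk : Converges (X := .nat) k V) (hl : Converges (X := .nat) l W) :
    Converges (X := .nat) (Tm.convPairing.eval I ρ k l) fun S => pairingD (V S) (W S) :=
  Converges.bind (X := .nat) I _ (F := fun n S => pairingD n (W S)) hk fun n =>
    Converges.bind (X := .nat) I _ (F := fun m _ => pairingD n m) hl fun m =>
      Converges.const (X := .nat) I _ (pairingD n m)

/-- The nesting of moduli is that of `Converges.bind`, but the outer values are states rather than
numbers, and the second family does not depend on them. -/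
theorem Converges.cup (I : Interp C') (ρ : Env Γ) {k l : (Ty.conv Ty.rep : Ty B').den}
    {V W : KState → KState} (hk : Converges (X := Ty.rep) k fun S => (V S).rep)
    (hl : Converges (X := Ty.rep) l fun S => (W S).rep) :
    Converges (X := Ty.rep) (Tm.convCup.eval I ρ k l) fun S => ((V S).cup (W S)).rep := by
  refine ⟨fun S => ?_, fun s hs h hh a => ?_⟩
  · funext x
    have e : (Tm.convCup.eval I ρ k l).1 S.rep x =
      (Nat.rec (l.1 S.rep x) (fun i _ => Nat.succ i) (k.1 S.rep x) : ℕ) := rfl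
    rw [e, hk.1 S, hl.1 S]
    exact (KState.rep_cup _ _ x).symm
  · let g : ℕ → ℕ := fun j => l.2 (fun i : ℕ => (s i).rep) h j
    have hg : ∀ j, j ≤ g j ∧ ∀ i, g j ≤ i → i ≤ h (g j) → W (s i) = W (s (g j)) := by
      intro j
      obtain ⟨m, em, hjm, hm⟩ := hl.2 s hs h hh j
      have em : m = g j := em
      subst em
      exact ⟨hjm, fun i hi hi' => KState.rep_injective (hm i hi hi')⟩
    obtain ⟨m, em, ham, hm⟩ :=
      hk.2 s hs (fun j => h (g j)) (fun j => (hg j).1.trans (hh _)) a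
    refine ⟨g m, congrArg g em, ham.trans (hg m).1, fun i hi hi' => ?_⟩
    have h₁ := KState.rep_injective (hm i ((hg m).1.trans hi) hi')
    have h₂ := KState.rep_injective (hm _ (hg m).1 (hh _))
    exact congrArg KState.rep
      (congr (congrArg KState.cup (h₁.trans h₂.symm)) ((hg m).2 i hi hi'))

/-! ## Correctness of the translation -/

/-- No atom of `S'` has its key in `S`. -/
def KState.Fresh (S S' : KState) : Prop := ∀ a ∈ S'.carrier, ∀ b ∈ S.carrier, b.key ≠ a.key

/-- The relation between objects of a translated type and families of objects indexed by
states. -/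
def Ty.StarRel {B : Type} : (A : Ty B) → (Ty.star A : Ty B').den → (KState → A.den) → Prop
  | .nat, k, V => Converges (X := .nat) k V
  | .bool, k, V => Converges (X := .nat) k fun S => (bif V S then 0 else 1 : ℕ)
  | .atom _, k, V =>
    Converges (X := Ty.rep) k (fun S => KState.rep (V S)) ∧ ∀ S : KState, S.Fresh (V S)
  | .prod U V, k, W =>
    Ty.StarRel U k.1 (fun S => (W S).1) ∧ Ty.StarRel V k.2 (fun S => (W S).2)
  | .arrow U V, f, F => ∀ x X, Ty.StarRel U x X → Ty.StarRel V (f x) (fun S => F S (X S))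

variable {B : Type} {C : Ty B → Type}

/-- Only base types need an argument, since `bind` acts componentwise on pairs and pointwise on
functions. Freshness is a statement about each single state and so passes to the selected family. -/
theorem Ty.StarRel.bind (I : Interp C') {k : (Ty.conv Ty.nat : Ty B').den} {V : KState → ℕ}
    (hk : Converges (X := .nat) k V) : {Γ : List (Ty B')} → (ρ : Env Γ) → (A : Ty B) →
    {f : ℕ → (Ty.star A : Ty B').den} → {F : ℕ → KState → A.den} →
    (∀ n, Ty.StarRel A (f n) (F n)) →
    Ty.StarRel A ((Tm.bind A).eval I ρ k f) fun S => F (V S) S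
  | _, ρ, .nat, _, _, hf => Converges.bind I ρ hk hf
  | _, ρ, .bool, _, F, hf =>
    Converges.bind (X := .nat) I ρ (F := fun n S => (bif F n S then 0 else 1 : ℕ)) hk hf
  | _, ρ, .atom _, _, F, hf =>
    ⟨Converges.bind (X := Ty.rep) I ρ (F := fun n S => KState.rep (F n S)) hk fun n => (hf n).1,
      fun S => (hf (V S)).2 S⟩
  | _, _, .prod U V, _, F, hf =>
    ⟨Ty.StarRel.bind I hk _ U (F := fun n S => (F n S).1) fun n => (hf n).1,
      Ty.StarRel.bind I hk _ V (F := fun n S => (F n S).2) fun n => (hf n).2⟩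
  | _, _, .arrow _ V, _, F, hf => fun _ X hx =>
    Ty.StarRel.bind I hk _ V (F := fun n S => F n S (X S)) fun n => hf n _ _ hx

/-- Fundamental lemma of the translation. The predicate `p` restricts which constants may occur; for
`T_Class` it excludes the nonempty states. -/
theorem Ty.starRel_eval (I : KState → Interp C) (I' : Interp C')
    {c' : ∀ A, C A → Tm C' [] (Ty.star A)} {p : ∀ A, C A → Prop}
    (hC : ∀ A c, p A c → Ty.StarRel A ((c' A c).eval I' Env.nil) fun S => I S A c)
    {Γ : List (Ty B)} {A : Ty B} (t : Tm C Γ A) (ht : t.AllConst p) :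
    ∀ (ρ' : Env (Γ.map (Ty.star (B' := B')))) (ρ : KState → Env Γ),
      (∀ A (v : Var Γ A), Ty.StarRel A (ρ' _ v.star) fun S => ρ S A v) →
      Ty.StarRel A ((t.star c').eval I' ρ') fun S => t.eval (I S) (ρ S) := by
  induction t with
  | var v => exact fun ρ' ρ h => h _ v
  | const c =>
    intro ρ' ρ h
    have e := Tm.eval_weak I' (c' _ c) ρ'
    exact e ▸ hC _ c ht
  | zero => exact fun ρ' ρ h => Converges.const (X := .nat) I' _ (0 : ℕ)
  | tt => exact fun ρ' ρ h => Converges.const (X := .nat) I' _ (0 : ℕ)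
  | ff => exact fun ρ' ρ h => Converges.const (X := .nat) I' _ (1 : ℕ)
  | ite A =>
    intro ρ' ρ h b X hb u U hu v V hv
    -- The boolean enters as a family of numbers, and each number selects a branch.
    have key := Ty.StarRel.bind I' hb (Env.cons v (Env.cons u (Env.cons b ρ'))) A
      (f := fun n => Nat.rec u (fun _ _ => v) n) (F := fun n => Nat.rec U (fun _ _ => V) n)
      (fun n => by
        cases n with
        | zero => exact hu
        | succ n => exact hv)
    refine cast (congrArg (Ty.StarRel A _) ?_) key
    funext S
    change Nat.rec U (fun _ _ => V) (bif X S then 0 else 1) S = bif X S then U S else V S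
    cases X S <;> rfl
  | recr A =>
    intro ρ' ρ h u U hu v V hv k N hk
    have key := Ty.StarRel.bind I' hk (Env.cons k (Env.cons v (Env.cons u ρ'))) A
      (f := fun n => Nat.rec u
        (fun i r => v ((Tm.convConst .nat).eval I' (Env.cons r (Env.cons (U := .nat) i (Env.cons (U := .nat) n
          (Env.cons k (Env.cons v (Env.cons u ρ')))))) i) r) n)
      (F := fun n S => Nat.rec (U S) (fun i r => V S i r) n)
      (fun n => by
        have : ∀ j, Ty.StarRel A (Nat.rec u
            (fun i r => v ((Tm.convConst .nat).eval I' (Env.cons r (Env.cons (U := .nat) i (Env.cons (U := .nat) n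
              (Env.cons k (Env.cons v (Env.cons u ρ')))))) i) r) j)
            fun S => Nat.rec (U S) (fun i r => V S i r) j := by
          intro j
          induction j with
          | zero => exact hu
          | succ j ih => exact hv _ _ (Converges.const (X := .nat) I' _ j) _ _ ih
        exact this n)
    exact key
  | succ t ih => exact fun ρ' ρ h => Converges.succ I' _ (ih ht ρ' ρ h)
  | app t u iht ihu => exact fun ρ' ρ h => iht ht.1 ρ' ρ h _ _ (ihu ht.2 ρ' ρ h)
  | fst t ih => exact fun ρ' ρ h => (ih ht ρ' ρ h).1
  | snd t ih => exact fun ρ' ρ h => (ih ht ρ' ρ h).2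
  | pair t u iht ihu => exact fun ρ' ρ h => ⟨iht ht.1 ρ' ρ h, ihu ht.2 ρ' ρ h⟩
  | lam t ih =>
    intro ρ' ρ h x X hx
    refine ih ht (Env.cons x ρ') (fun S => Env.cons (X S) (ρ S)) ?_
    intro A v
    cases v with
    | z => exact hx
    | s v => exact h _ v

end Convergence

/-! ### Oracles, Skolem maps and new atoms read off the representation of a state. -/

open Classical in
theorem KState.rec_rep_oracle (S : KState) (P : Pred) (n : Fin P.k → ℕ) :
    (Nat.rec 1 (fun _ _ => 0) (S.rep (keyCode P n)) : ℕ) =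
      bif decide (∃ m, S.Mem P n m) then 0 else 1 := by
  by_cases h : ∃ m, S.Mem P n m
  · rw [KState.rep_eq_succ h.choose_spec, decide_eq_true h]
    rfl
  · rw [KState.rep_eq_zero_of_not_exists h, decide_eq_false h]
    rfl

theorem KState.rec_rep_witness (S : KState) (P : Pred) (n : Fin P.k → ℕ) :
    (Nat.rec 0 (fun i _ => i) (S.rep (keyCode P n)) : ℕ) = S.witness P n := by
  by_cases h : ∃ m, S.Mem P n m
  · rw [KState.rep_eq_succ h.choose_spec, KState.witness, dif_pos h]
  · rw [KState.rep_eq_zero_of_not_exists h, KState.witness, dif_neg h]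
    rfl

/-- The outer zero test asks whether the key is known and the inner one whether the predicate holds,
matching the cases of `KState.update`. -/
theorem KState.rec_rep_update (S : KState) (P : Pred) (n : Fin P.k → ℕ) (m x : ℕ) {b : Bool}
    (hb : b = Ty.appsD P.k P.val n m) :
    (Nat.rec (Nat.rec (singleD (keyCode P n) m x) (fun _ _ => 0) (bif b then 0 else 1 : ℕ))
      (fun _ _ => 0) (S.rep (keyCode P n)) : ℕ) = (S.update P n m).rep x := by
  by_cases h : ∃ l, S.Mem P n l
  · rw [KState.rep_eq_succ h.choose_spec, KState.update, dif_neg fun h' => h'.2 h,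
      KState.rep_empty]
  · rw [KState.rep_eq_zero_of_not_exists h]
    by_cases h' : TEq (P.at n m) .tt
    · rw [KState.update, dif_pos ⟨h', h⟩, KState.rep_singleton]
      rw [TTm.teq_tt, Pred.eval_at] at h'
      rw [hb.trans h']
      rfl
    · rw [KState.update, dif_neg fun h'' => h' h''.1, KState.rep_empty]
      rw [TTm.teq_tt, Pred.eval_at] at h'
      rw [hb.trans (Bool.eq_false_of_not_eq_true h')]
      rfl

/-- New atoms originate only here, and only at an unknown key; `cup` merely combines atoms, so every
state computed by a realizer is fresh. -/
theorem KState.fresh_update (S : KState) (P : Pred) (n : Fin P.k → ℕ) (m : ℕ) :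
    S.Fresh (S.update P n m) := by
  intro a ha b hb e
  by_cases h : TEq (P.at n m) .tt ∧ ¬ ∃ l, S.Mem P n l
  · rw [KState.update, dif_pos h] at ha
    cases Set.mem_singleton_iff.1 ha
    exact h.2 ⟨b.wit, b, hb, e, rfl⟩
  · rw [KState.update, dif_neg h] at ha
    exact Set.notMem_empty a ha

/-! ## Correctness of the translation of `T_Class` -/

section Constants

variable {B' : Type} {C' : Ty B' → Type} {Γ : List (Ty B')}

theorem TTm.allConst_true {Γ : List TyT} {A : TyT} (t : TTm Γ A) :
    t.AllConst fun _ _ => True := by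
  induction t with
  | succ t ih => exact ih
  | app t u iht ihu => exact ⟨iht, ihu⟩
  | fst t ih => exact ih
  | snd t ih => exact ih
  | pair t u iht ihu => exact ⟨iht, ihu⟩
  | lam t ih => exact ih
  | _ => trivial

theorem Pred.starRel_val (P : Pred) (I' : Interp C') :
    Ty.StarRel _ ((Tm.star (C' := C') (fun _ c => nomatch c) P.tm).eval I' Env.nil)
      fun _ => P.val :=
  Ty.starRel_eval (fun _ => TTm.interp) I' (fun _ c => nomatch c) P.tm (TTm.allConst_true _)
    Env.nil (fun _ => Env.nil) fun _ v => nomatch v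

/-- The accumulated code and the partially applied predicate must come from the same arguments. The
invariant says that, at each state, any remaining vector n completes them to a full vector N with
the right code, predicate and value; N depends on the state because the arguments do. -/
theorem Ty.starRel_starCurry (I' : Interp C') (P : Pred) (A : TyS)
    (D : ∀ Γ, Tm C' Γ (Ty.nat ⇒ₜ (Ty.conv .nat ⇒ₜ Ty.conv .nat) ⇒ₜ Ty.conv .nat ⇒ₜ Ty.star A))
    (F : KState → (Fin P.k → ℕ) → A.den)
    (hD : ∀ (Γ : List (Ty B')) (ρ : Env Γ) (q : _) (Q : KState → ℕ → Bool)
      (k : (Ty.conv Ty.nat : Ty B').den) (V : KState → ℕ) (N : KState → Fin P.k → ℕ),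
      Ty.StarRel (Ty.nat ⇒ₜ Ty.bool : TyT) q Q → Converges (X := .nat) k V →
      (∀ S, V S = vecCode 0 P.k (N S)) → (∀ S, Q S = Ty.appsD P.k P.val (N S)) →
      Ty.StarRel A ((D Γ).eval I' ρ P.code q k) fun S => F S (N S)) :
    (j : ℕ) → {Γ : List (Ty B')} → (ρ : Env Γ) → (q : _) →
      (Q : KState → (Ty.curry j (Ty.nat ⇒ₜ Ty.bool) : TyT).den) →
      (k : (Ty.conv Ty.nat : Ty B').den) → (V : KState → ℕ) → (Y : KState → (Ty.curry j A).den) →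
      Ty.StarRel _ q Q → Converges (X := .nat) k V →
      (∀ S (n : Fin j → ℕ), ∃ N : Fin P.k → ℕ, vecCode (V S) j n = vecCode 0 P.k N ∧
        Ty.appsD j (Q S) n = Ty.appsD P.k P.val N ∧ Ty.appsD j (Y S) n = F S N) →
      Ty.StarRel (Ty.curry j A) ((Tm.starCurry A D P.code j).eval I' ρ q k) Y
  | 0, Γ, ρ, q, Q, k, V, Y, hq, hk, h => by
    choose N hV hQ hY using fun S => h S Fin.elim0
    have h₁ := hD Γ ρ q Q k V N hq hk hV hQ
    have e : Y = fun S => F S (N S) := funext hY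
    rw [e]
    have e' : Tm.eval I' (Tm.starCurry A D P.code 0) ρ = Tm.eval I' (D Γ) ρ P.code :=
      congrArg (Tm.eval I' (D Γ) ρ) (Tm.eval_numeral I' _ ρ)
    exact e' ▸ h₁
  | j + 1, Γ, ρ, q, Q, k, V, Y, hq, hk, h => by
    intro x X hx
    refine Ty.starRel_starCurry I' P A D F hD j _ _ (fun S => Q S (X S)) _
      (fun S => pairingD (V S) (X S)) _ (hq x X hx) (Converges.pairing I' _ hk hx) ?_
    intro S n
    exact h S (Fin.cons (X S) n)

theorem Ty.starRel_curry (I' : Interp C') (P : Pred) (A : TyS)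
    (D : ∀ Γ, Tm C' Γ (Ty.nat ⇒ₜ (Ty.conv .nat ⇒ₜ Ty.conv .nat) ⇒ₜ Ty.conv .nat ⇒ₜ Ty.star A))
    (F : KState → (Fin P.k → ℕ) → A.den)
    (hD : ∀ (Γ : List (Ty B')) (ρ : Env Γ) (q : _) (Q : KState → ℕ → Bool)
      (k : (Ty.conv Ty.nat : Ty B').den) (V : KState → ℕ) (N : KState → Fin P.k → ℕ),
      Ty.StarRel (Ty.nat ⇒ₜ Ty.bool : TyT) q Q → Converges (X := .nat) k V →
      (∀ S, V S = vecCode 0 P.k (N S)) → (∀ S, Q S = Ty.appsD P.k P.val (N S)) →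
      Ty.StarRel A ((D Γ).eval I' ρ P.code q k) fun S => F S (N S)) :
    Ty.StarRel (Ty.curry P.k A)
      ((Tm.app (.app (.starCurry A D P.code P.k) (.star (fun _ c => nomatch c) P.tm))
        (.app (.convConst .nat) .zero)).eval I' Env.nil) fun S => Ty.curryD P.k (F S) :=
  Ty.starRel_starCurry I' P A D F hD P.k _ _ (fun _ => P.val) _ (fun _ => 0) _
    (P.starRel_val I') (Converges.const (X := .nat) I' _ (0 : ℕ))
    fun _ n => ⟨n, rfl, rfl, Ty.appsD_curryD _ _ _⟩

theorem Converges.lookup_key (I' : Interp C') (ρ : Env Γ) {X : Ty B'} (p : ℕ)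
    {k : (Ty.conv Ty.nat : Ty B').den} {V : KState → ℕ} (hk : Converges (X := .nat) k V)
    {f : ℕ → ℕ → (Ty.conv X).den} {F : ℕ → ℕ → X.den}
    (hf : ∀ c y, Converges (f c y) fun _ => F c y) :
    Converges ((Tm.convBind X).eval I' ρ k fun c : ℕ => (Tm.convBind X).eval I'
      (Env.cons (U := .nat) c ρ) (Tm.convLookup.eval I' (Env.cons (U := .nat) c ρ) (pairingD c p))
      (f c)) fun S => F (V S) (S.rep (pairingD (V S) p)) :=
  Converges.bind I' _ (F := fun c S => F c (S.rep (pairingD c p))) hk fun c =>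
    Converges.bind I' _ (F := fun y _ => F c y) (Converges.lookup I' _ _) (hf c)

theorem ClassConst.starRel_star (I' : Interp C') (A : TyS) (c : ClassConst A)
    (hc : ClassConst.StateEmpty A c) :
    Ty.StarRel A ((ClassConst.star A c : Tm C' [] _).eval I' Env.nil)
      fun S => ClassTm.interp S A c := by
  classical
  cases c with
  | st S =>
    -- A nonempty state is not fresh for itself, so ∅ is the only state constant that can be
    -- allowed.
    cases hc
    have e : KState.empty.rep = fun _ => 0 := funext KState.rep_empty
    refine ⟨?_, fun S a ha => absurd ha (Set.notMem_empty a)⟩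
    change Converges (X := Ty.rep) _ fun _ => KState.empty.rep
    rw [e]
    exact Converges.const (X := Ty.rep) I' Env.nil fun _ : ℕ => (0 : ℕ)
  | cup =>
    intro k V hk l W hl
    refine ⟨Converges.cup I' _ hk.1 hl.1, fun S a ha => ?_⟩
    rcases ha with ha | ha
    · exact hk.2 S a ha
    · exact hl.2 S a ha.1
  | oracle P =>
    refine Ty.starRel_curry I' P Ty.bool _ (fun S n => decide (∃ m, S.Mem P n m)) ?_
    intro Γ ρ q Q k V N hq hk hV hQ
    have key := Converges.lookup_key I' (Env.cons k (Env.cons q (Env.cons (U := .nat) P.code ρ)))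
      (X := .nat) P.code hk
      (f := fun c y => (Tm.convConst .nat).eval I' (Env.cons (U := .nat) y (Env.cons (U := .nat) c
        (Env.cons k (Env.cons q (Env.cons (U := .nat) P.code ρ)))))
        (Nat.rec (motive := fun _ => ℕ) 1 (fun _ _ => 0) y))
      (fun c y => Converges.const (X := .nat) I' _ _)
    refine cast (congrArg (Converges (X := .nat) _) ?_) key
    funext S
    rw [hV S]
    exact S.rec_rep_oracle P (N S)
  | skolem P =>
    refine Ty.starRel_curry I' P Ty.nat _ (fun S n => S.witness P n) ?_
    intro Γ ρ q Q k V N hq hk hV hQ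
    have key := Converges.lookup_key I' (Env.cons k (Env.cons q (Env.cons (U := .nat) P.code ρ)))
      (X := .nat) P.code hk
      (f := fun c y => (Tm.convConst .nat).eval I' (Env.cons (U := .nat) y (Env.cons (U := .nat) c
        (Env.cons k (Env.cons q (Env.cons (U := .nat) P.code ρ)))))
        (Nat.rec (motive := fun _ => ℕ) 0 (fun i _ => i) y))
      (fun c y => Converges.const (X := .nat) I' _ _)
    refine cast (congrArg (Converges (X := .nat) _) ?_) key
    funext S
    rw [hV S]
    exact S.rec_rep_witness P (N S)
  | add P =>
    refine Ty.starRel_curry I' P (Ty.nat ⇒ₜ TyS.state) _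
      (fun S n => fun m : ℕ => S.update P n m) ?_
    intro Γ ρ q Q k V N hq hk hV hQ l M hl
    refine ⟨?_, fun S => S.fresh_update P (N S) (M S)⟩
    -- Four quantities may vary with the state: the truth value b, the witness m, the code c of the
    -- vector and the entry at the key. They are frozen in this order, after which the result is
    -- constant.
    · have key := Converges.bind (X := Ty.rep) I' (Env.cons l (Env.cons k (Env.cons q
          (Env.cons (U := .nat) P.code ρ))))
        (F := fun b S x => (Nat.rec (Nat.rec (singleD (pairingD (V S) P.code) (M S) x)
          (fun _ _ => 0) b) (fun _ _ => 0) (S.rep (pairingD (V S) P.code)) : ℕ))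
        (hq l M hl) fun b =>
        Converges.bind (X := Ty.rep) I' (Env.cons (U := .nat) b (Env.cons l (Env.cons k (Env.cons q
          (Env.cons (U := .nat) P.code ρ)))))
        (F := fun m S x => (Nat.rec (Nat.rec (singleD (pairingD (V S) P.code) m x)
          (fun _ _ => 0) b) (fun _ _ => 0) (S.rep (pairingD (V S) P.code)) : ℕ))
        hl fun m =>
        Converges.lookup_key I' (Env.cons (U := .nat) m (Env.cons (U := .nat) b (Env.cons l
          (Env.cons k (Env.cons q (Env.cons (U := .nat) P.code ρ))))))
          (X := Ty.rep) P.code hk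
          (F := fun c y x => (Nat.rec (Nat.rec (singleD (pairingD c P.code) m x)
            (fun _ _ => 0) b) (fun _ _ => 0) y : ℕ))
          fun c y => Converges.const (X := Ty.rep) I' (Env.cons (U := .nat) y
            (Env.cons (U := .nat) c (Env.cons (U := .nat) m (Env.cons (U := .nat) b (Env.cons l
            (Env.cons k (Env.cons q (Env.cons (U := .nat) P.code ρ)))))))) _
      refine cast (congrArg (Converges (X := Ty.rep) _) ?_) key
      funext S x
      rw [hV S]
      exact S.rec_rep_update P (N S) (M S) x (congrFun (hQ S) (M S))

theorem ClassTm.starRel_star (I' : Interp C') {A : TyS} (t : ClassTm [] A) (ht : t.StateEmpty) :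
    Ty.StarRel A ((t.star ClassConst.star : Tm C' [] _).eval I' Env.nil)
      fun S => t.eval (ClassTm.interp S) Env.nil :=
  Ty.starRel_eval ClassTm.interp I' (ClassConst.starRel_star I') t ht Env.nil (fun _ => Env.nil)
    fun _ v => nomatch v

end Constants

/-! ## Learning -/

/-- The sequence of states produced by `Y`. -/
def KState.learn (Y : KState → KState) : ℕ → KState
  | 0 => .empty
  | i + 1 => (KState.learn Y i).cup (Y (KState.learn Y i))

theorem KState.learn_mono (Y : KState → KState) (i j : ℕ) (h : i ≤ j) :
    (KState.learn Y i).carrier ⊆ (KState.learn Y j).carrier := by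
  induction h with
  | refl => exact subset_rfl
  | step _ ih => exact ih.trans Set.subset_union_left

/-- By freshness every atom of Y S survives in the union. If the same atom is proposed again there,
freshness is violated. -/
theorem KState.eq_empty_of_stationary {S : KState} {Y : KState → KState}
    (hY : ∀ S : KState, S.Fresh (Y S)) (h : Y (S.cup (Y S)) = Y S) : Y S = .empty := by
  refine KState.ext (Set.eq_empty_of_forall_notMem fun a ha => ?_)
  have h₁ : a ∈ (S.cup (Y S)).carrier :=
    Or.inr ⟨ha, fun b hb e => absurd e (hY S a ha b hb)⟩
  exact hY (S.cup (Y S)) a (h.symm ▸ ha) a h₁ rfl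

section Learning

variable {B' : Type} {C' : Ty B' → Type} {Γ : List (Ty B')}

theorem KState.eval_learning (I : Interp C') (ρ : Env Γ) {k : (Ty.conv Ty.rep : Ty B').den}
    {Y : KState → KState} (hk : Converges (X := Ty.rep) k fun S => (Y S).rep) (i : ℕ) :
    Tm.learning.eval I ρ k i = (KState.learn Y i).rep := by
  induction i with
  | zero => exact (funext KState.rep_empty).symm
  | succ i ih =>
    funext x
    have e : Tm.learning.eval I ρ k (i + 1) x =
      (Nat.rec (k.1 (Tm.learning.eval I ρ k i) x) (fun i _ => Nat.succ i)
        (Tm.learning.eval I ρ k i x) : ℕ) := rfl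
    rw [e, ih, hk.1]
    exact (KState.rep_cup _ _ x).symm

/-- For h = successor the stable interval is [m, m + 1], so two consecutive proposals coincide, and
freshness makes them empty. -/
theorem KState.learn_stationary (I : Interp C') (ρ : Env Γ) {k : (Ty.conv Ty.rep : Ty B').den}
    {Y : KState → KState} (hk : Converges (X := Ty.rep) k fun S => (Y S).rep)
    (hY : ∀ S : KState, S.Fresh (Y S)) :
    Y (KState.learn Y (Tm.stationary.eval I ρ k)) = .empty := by
  obtain ⟨m, em, -, hm⟩ :=
    hk.2 (KState.learn Y) (KState.learn_mono Y) Nat.succ (fun i => Nat.le_succ i) 0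
  have e : Tm.stationary.eval I ρ k = m := by
    refine Eq.trans ?_ em.symm
    exact congrArg (fun s => k.2 s Nat.succ (0 : ℕ)) (funext fun i => KState.eval_learning I _ hk i)
  rw [e]
  exact KState.eq_empty_of_stationary hY (KState.rep_injective (hm (m + 1) (Nat.le_succ m) le_rfl))

end Learning

/-! ## Recursion on Gödel numbers -/

/-- The list of the first `n` values of the function defined by course-of-values recursion. -/
def recValues (step : List ℕ → ℕ) : ℕ → List ℕ
  | 0 => []
  | n + 1 => recValues step n ++ [step (recValues step n)]

/-- The function defined by course-of-values recursion. -/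
def recCode (step : List ℕ → ℕ) (n : ℕ) : ℕ := step (recValues step n)

theorem recValues_length (step : List ℕ → ℕ) (n : ℕ) : (recValues step n).length = n := by
  induction n with
  | zero => rfl
  | succ n ih => simp [recValues, ih]

theorem recValues_getD (step : List ℕ → ℕ) {i n : ℕ} (h : i < n) :
    (recValues step n).getD i 0 = recCode step i := by
  induction n with
  | zero => exact absurd h (Nat.not_lt_zero i)
  | succ n ih =>
    rw [recValues]
    rcases Nat.lt_succ_iff_lt_or_eq.1 h with h | rfl
    · rw [List.getD_append _ _ _ _ (by rwa [recValues_length]), ih h]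
    · rw [List.getD_append_right _ _ _ _ (by rw [recValues_length]), recValues_length,
        Nat.sub_self]
      rfl

/-- The table of earlier values is itself defined by primitive recursion; a step reads its own
argument as the length of the table. -/
theorem recCode_primrec {step : List ℕ → ℕ} (h : Primrec step) : Primrec (recCode step) := by
  have h₁ : Primrec (recValues step) := by
    refine (Primrec.nat_rec₁ (f := fun _ l => l ++ [step l]) []
      (Primrec.list_concat.comp .snd (h.comp .snd)).to₂).of_eq fun n => ?_
    induction n with
    | zero => rfl
    | succ n ih => exact (congrArg (fun l => l ++ [step l]) ih)
  exact h.comp h₁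

/-- Strictness needs a positive tag, which every compound type or term carries; it places the codes
of the parts inside the table. -/
theorem lt_pair_succ (a b : ℕ) : b < Nat.pair (a + 1) b := by
  have := Nat.add_le_pair (a + 1) b
  omega

section Primrec

variable {α : Type} [Primcodable α] {f g h : α → ℕ}

theorem primrec_pair (hf : Primrec f) (hg : Primrec g) :
    Primrec fun x => Nat.pair (f x) (g x) :=
  Primrec₂.natPair.comp hf hg

theorem primrec_left (hf : Primrec f) : Primrec fun x => (f x).unpair.1 :=
  Primrec.fst.comp (Primrec.unpair.comp hf)

theorem primrec_right (hf : Primrec f) : Primrec fun x => (f x).unpair.2 :=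
  Primrec.snd.comp (Primrec.unpair.comp hf)

theorem primrec_ite_eq (n : ℕ) (hf : Primrec f) (hg : Primrec g) (hh : Primrec h) :
    Primrec fun x => if f x = n then g x else h x :=
  Primrec.ite (Primrec.eq.comp hf (Primrec.const n)) hg hh

theorem primrec_getD {l : α → List ℕ} (hl : Primrec l) (hf : Primrec f) :
    Primrec fun x => (l x).getD (f x) 0 :=
  (Primrec.list_getD 0).comp hl hf

end Primrec

/-! ## Gödel numbers of terms of system T -/

/-- Gödel numbers of types of system T. -/
def TyT.code (A : TyT) : ℕ := Ty.code (fun e => nomatch e) A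

def codeVar (i : ℕ) : ℕ := Nat.pair 0 i
def codeZero : ℕ := Nat.pair 2 0
def codeRec (a : ℕ) : ℕ := Nat.pair 6 a
def codeSucc (t : ℕ) : ℕ := Nat.pair 7 t
def codeApp (a t u : ℕ) : ℕ := Nat.pair 8 (Nat.pair a (Nat.pair t u))
def codeFst (a t : ℕ) : ℕ := Nat.pair 9 (Nat.pair a t)
def codeSnd (a t : ℕ) : ℕ := Nat.pair 10 (Nat.pair a t)
def codePair (t u : ℕ) : ℕ := Nat.pair 11 (Nat.pair t u)
def codeLam (a t : ℕ) : ℕ := Nat.pair 12 (Nat.pair a t)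
def codeProd (a b : ℕ) : ℕ := Nat.pair 3 (Nat.pair a b)
def codeArrow (a b : ℕ) : ℕ := Nat.pair 4 (Nat.pair a b)

theorem TyT.code_arrow (U V : TyT) : TyT.code (U ⇒ₜ V) = codeArrow U.code V.code := rfl

namespace TTm

variable {Γ : List TyT} {U V : TyT}

theorem code_var (v : Var Γ U) : TTm.code (.var v) = codeVar v.index := rfl
theorem code_recr (A : TyT) : TTm.code (.recr A : TTm Γ _) = codeRec A.code := rfl
theorem code_app (t : TTm Γ (U ⇒ₜ V)) (u : TTm Γ U) :
    TTm.code (.app t u) = codeApp U.code t.code u.code := rfl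
theorem code_lam (t : TTm (U :: Γ) V) : TTm.code (.lam t) = codeLam U.code t.code := rfl

/-- Codes mention only indices and types, so the combinators have the same code in every context. -/
theorem code_ren {A : TyT} (t : TTm Γ A) : ∀ {Δ : List TyT} (r : ∀ A, Var Γ A → Var Δ A),
    (∀ A v, (r A v).index = v.index) → TTm.code (Tm.ren r t) = t.code := by
  induction t with
  | var v => exact fun r hr => congrArg codeVar (hr _ v)
  | succ t ih => exact fun r hr => congrArg codeSucc (ih r hr)
  | app t u iht ihu => exact fun r hr => congr (congrArg (codeApp _) (iht r hr)) (ihu r hr)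
  | fst t ih => exact fun r hr => congrArg (codeFst _) (ih r hr)
  | snd t ih => exact fun r hr => congrArg (codeSnd _) (ih r hr)
  | pair t u iht ihu => exact fun r hr => congr (congrArg codePair (iht r hr)) (ihu r hr)
  | lam t ih =>
    intro Δ r hr
    refine congrArg (codeLam _) (ih (Tm.liftRen r) fun A v => ?_)
    cases v with
    | z => rfl
    | s v => exact congrArg (· + 1) (hr _ v)
  | _ => intros; rfl

theorem code_weak {A : TyT} (t : TTm [] A) : TTm.code (Tm.weak t : TTm Γ A) = t.code :=
  code_ren t _ fun _ v => nomatch v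

end TTm

/-- The Gödel number of a numeral. -/
def codeNumeral : ℕ → ℕ
  | 0 => codeZero
  | n + 1 => codeSucc (codeNumeral n)

theorem TTm.code_numeral {Γ : List TyT} (n : ℕ) :
    TTm.code (.numeral n : TTm Γ .nat) = codeNumeral n := by
  induction n with
  | zero => rfl
  | succ n ih => exact congrArg codeSucc ih

section Primrec

variable {α : Type} [Primcodable α] {f g h : α → ℕ}

theorem codeRec_primrec (hf : Primrec f) : Primrec fun x => codeRec (f x) :=
  primrec_pair (.const _) hf

theorem codeApp_primrec (hf : Primrec f) (hg : Primrec g) (hh : Primrec h) :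
    Primrec fun x => codeApp (f x) (g x) (h x) :=
  primrec_pair (.const _) (primrec_pair hf (primrec_pair hg hh))

theorem codeFst_primrec (hf : Primrec f) (hg : Primrec g) :
    Primrec fun x => codeFst (f x) (g x) :=
  primrec_pair (.const _) (primrec_pair hf hg)

theorem codeSnd_primrec (hf : Primrec f) (hg : Primrec g) :
    Primrec fun x => codeSnd (f x) (g x) :=
  primrec_pair (.const _) (primrec_pair hf hg)

theorem codePair_primrec (hf : Primrec f) (hg : Primrec g) :
    Primrec fun x => codePair (f x) (g x) :=
  primrec_pair (.const _) (primrec_pair hf hg)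

theorem codeLam_primrec (hf : Primrec f) (hg : Primrec g) :
    Primrec fun x => codeLam (f x) (g x) :=
  primrec_pair (.const _) (primrec_pair hf hg)

theorem codeProd_primrec (hf : Primrec f) (hg : Primrec g) :
    Primrec fun x => codeProd (f x) (g x) :=
  primrec_pair (.const _) (primrec_pair hf hg)

theorem codeArrow_primrec (hf : Primrec f) (hg : Primrec g) :
    Primrec fun x => codeArrow (f x) (g x) :=
  primrec_pair (.const _) (primrec_pair hf hg)

theorem codeNumeral_primrec : Primrec codeNumeral := by
  refine (Primrec.nat_rec₁ (f := fun _ t => codeSucc t) codeZero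
    (primrec_pair (.const _) .snd).to₂).of_eq fun n => ?_
  induction n with
  | zero => rfl
  | succ n ih => exact congrArg codeSucc ih

end Primrec

/-! ## The Gödel number of the translation of a term -/

def codeNat : ℕ := TyT.code .nat
def codeConv : ℕ := TyT.code (Ty.conv .nat)
def codeConvRep : ℕ := TyT.code (Ty.conv Ty.rep)
def codeConvConst : ℕ := TTm.code (Tm.convConst .nat : TTm [] _)
def codeConvSucc : ℕ := TTm.code (Tm.convSucc : TTm [] _)
def codeConvPairing : ℕ := TTm.code (Tm.convPairing : TTm [] _)
def codeConvBind : ℕ := TTm.code (Tm.convBind .nat : TTm [] _)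
def codeConvBindRep : ℕ := TTm.code (Tm.convBind Ty.rep : TTm [] _)

theorem TTm.code_convConst {Γ : List TyT} :
    TTm.code (Tm.convConst .nat : TTm Γ _) = codeConvConst :=
  TTm.code_weak (Tm.convConst .nat : TTm [] _)

theorem TTm.code_convSucc {Γ : List TyT} :
    TTm.code (Tm.convSucc : TTm Γ _) = codeConvSucc :=
  TTm.code_weak (Tm.convSucc : TTm [] _)

theorem TTm.code_convPairing {Γ : List TyT} :
    TTm.code (Tm.convPairing : TTm Γ _) = codeConvPairing :=
  TTm.code_weak (Tm.convPairing : TTm [] _)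

theorem TTm.code_convBind {Γ : List TyT} :
    TTm.code (Tm.convBind .nat : TTm Γ _) = codeConvBind :=
  TTm.code_weak (Tm.convBind .nat : TTm [] _)

theorem TTm.code_convBindRep {Γ : List TyT} :
    TTm.code (Tm.convBind Ty.rep : TTm Γ _) = codeConvBindRep :=
  TTm.code_weak (Tm.convBind Ty.rep : TTm [] _)

/-- The Gödel number of `Tm.bind` at a product. -/
def codeBindProd (u bu v bv : ℕ) : ℕ :=
  codeLam codeConv (codeLam (codeArrow codeNat (codeProd u v)) (codePair
    (codeApp (codeArrow codeNat u) (codeApp codeConv bu (codeVar 1))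
      (codeLam codeNat (codeFst v (codeApp codeNat (codeVar 1) (codeVar 0)))))
    (codeApp (codeArrow codeNat v) (codeApp codeConv bv (codeVar 1))
      (codeLam codeNat (codeSnd u (codeApp codeNat (codeVar 1) (codeVar 0)))))))

/-- The Gödel number of `Tm.bind` at a function type. -/
def codeBindArrow (u v bv : ℕ) : ℕ :=
  codeLam codeConv (codeLam (codeArrow codeNat (codeArrow u v)) (codeLam u
    (codeApp (codeArrow codeNat v) (codeApp codeConv bv (codeVar 2))
      (codeLam codeNat (codeApp u (codeApp codeNat (codeVar 2) (codeVar 0)) (codeVar 1))))))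

/-- One step of the computation of the Gödel numbers of the translation of a type and of
`Tm.bind`. -/
def typeStep (l : List ℕ) : ℕ :=
  if l.length.unpair.1 = 0 then Nat.pair codeConv codeConvBind
  else if l.length.unpair.1 = 1 then Nat.pair codeConv codeConvBind
  else if l.length.unpair.1 = 2 then Nat.pair codeConvRep codeConvBindRep
  else if l.length.unpair.1 = 3 then
    Nat.pair
      (codeProd (l.getD l.length.unpair.2.unpair.1 0).unpair.1
        (l.getD l.length.unpair.2.unpair.2 0).unpair.1)
      (codeBindProd (l.getD l.length.unpair.2.unpair.1 0).unpair.1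
        (l.getD l.length.unpair.2.unpair.1 0).unpair.2
        (l.getD l.length.unpair.2.unpair.2 0).unpair.1
        (l.getD l.length.unpair.2.unpair.2 0).unpair.2)
  else
    Nat.pair
      (codeArrow (l.getD l.length.unpair.2.unpair.1 0).unpair.1
        (l.getD l.length.unpair.2.unpair.2 0).unpair.1)
      (codeBindArrow (l.getD l.length.unpair.2.unpair.1 0).unpair.1
        (l.getD l.length.unpair.2.unpair.2 0).unpair.1
        (l.getD l.length.unpair.2.unpair.2 0).unpair.2)

/-- The Gödel numbers of the translation of a type and of `Tm.bind`. -/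
def codeTypeBind (a : ℕ) : ℕ := recCode typeStep a

section Irreducible

attribute [local irreducible] Nat.pair

theorem TTm.code_bind_prod {B : Type} {U V : Ty B} {bu bv : ℕ}
    (hU : ∀ Γ : List TyT, TTm.code (Tm.bind U : TTm Γ _) = bu)
    (hV : ∀ Γ : List TyT, TTm.code (Tm.bind V : TTm Γ _) = bv) (Γ : List TyT) :
    TTm.code (Tm.bind (.prod U V) : TTm Γ _) =
      codeBindProd (TyT.code (Ty.star U)) bu (TyT.code (Ty.star V)) bv :=
  congrArg (codeLam codeConv) (congrArg (codeLam _) (congr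
    (congrArg codePair (congrArg (fun t => codeApp _ (codeApp codeConv t (codeVar 1)) _) (hU _)))
    (congrArg (fun t => codeApp _ (codeApp codeConv t (codeVar 1)) _) (hV _))))

theorem TTm.code_bind_arrow {B : Type} {U V : Ty B} {bv : ℕ}
    (hV : ∀ Γ : List TyT, TTm.code (Tm.bind V : TTm Γ _) = bv) (Γ : List TyT) :
    TTm.code (Tm.bind (.arrow U V) : TTm Γ _) =
      codeBindArrow (TyT.code (Ty.star U)) (TyT.code (Ty.star V)) bv :=
  congrArg (codeLam codeConv) (congrArg (codeLam _) (congrArg (codeLam _)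
    (congrArg (fun t => codeApp _ (codeApp codeConv t (codeVar 2)) _) (hV _))))

/-- The two codes are computed together because `bind` at a compound type contains the translated
component types as annotations. The numbering `cB` is arbitrary, so the same function serves system
T and `T_Class`. -/
theorem codeTypeBind_code {B : Type} (cB : B → ℕ) (A : Ty B) (Γ : List TyT) :
    codeTypeBind (Ty.code cB A) =
      Nat.pair (TyT.code (Ty.star A)) (TTm.code (Tm.bind A : TTm Γ _)) := by
  have hstep : ∀ n, codeTypeBind n = typeStep (recValues typeStep n) := fun n => rfl
  have hbind : ∀ (A : Ty B) (Γ : List TyT),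
      TTm.code (Tm.bind A : TTm Γ _) = TTm.code (Tm.bind A : TTm [] _) := by
    intro A
    induction A with
    | nat => exact fun Γ => TTm.code_convBind
    | bool => exact fun Γ => TTm.code_convBind
    | atom b => exact fun Γ => TTm.code_convBindRep
    | prod U V ihU ihV =>
      exact fun Γ => (TTm.code_bind_prod ihU ihV Γ).trans (TTm.code_bind_prod ihU ihV []).symm
    | arrow U V ihU ihV =>
      exact fun Γ => (TTm.code_bind_arrow ihV Γ).trans (TTm.code_bind_arrow ihV []).symm
  rw [hbind A Γ]
  induction A with
  | nat =>
    simp only [hstep, typeStep, recValues_length, Ty.code, Nat.unpair_pair, if_true]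
    rfl
  | bool =>
    simp only [hstep, typeStep, recValues_length, Ty.code, Nat.unpair_pair,
      one_ne_zero, if_false, if_true]
    rfl
  | atom b =>
    simp only [hstep, typeStep, recValues_length, Ty.code, Nat.unpair_pair,
      reduceIte, OfNat.ofNat_ne_zero, OfNat.ofNat_ne_one]
    rfl
  | prod U V ihU ihV =>
    have h := lt_pair_succ 2 (Nat.pair (Ty.code cB U) (Ty.code cB V))
    simp only [hstep, typeStep, recValues_length, Ty.code, Nat.unpair_pair,
      reduceIte, OfNat.ofNat_ne_zero, OfNat.ofNat_ne_one, Nat.reduceEqDiff]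
    rw [recValues_getD _ ((Nat.left_le_pair _ _).trans_lt h),
      recValues_getD _ ((Nat.right_le_pair _ _).trans_lt h)]
    rw [codeTypeBind] at ihU ihV
    rw [ihU, ihV, TTm.code_bind_prod (hbind U) (hbind V)]
    simp only [Nat.unpair_pair]
    rfl
  | arrow U V ihU ihV =>
    have h := lt_pair_succ 3 (Nat.pair (Ty.code cB U) (Ty.code cB V))
    simp only [hstep, typeStep, recValues_length, Ty.code, Nat.unpair_pair,
      reduceIte, OfNat.ofNat_ne_zero, OfNat.ofNat_ne_one, Nat.reduceEqDiff]
    rw [recValues_getD _ ((Nat.left_le_pair _ _).trans_lt h),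
      recValues_getD _ ((Nat.right_le_pair _ _).trans_lt h)]
    rw [codeTypeBind] at ihU ihV
    rw [ihU, ihV, TTm.code_bind_arrow (hbind V)]
    simp only [Nat.unpair_pair]
    rfl

/-- The Gödel number of `Tm.starIte`. -/
def codeStarIte (a b : ℕ) : ℕ :=
  codeLam codeConv (codeLam a (codeLam a (codeApp (codeArrow codeNat a)
    (codeApp codeConv b (codeVar 2)) (codeLam codeNat (codeApp codeNat
      (codeApp (codeArrow codeNat (codeArrow a a)) (codeApp a (codeRec a) (codeVar 2))
        (codeLam codeNat (codeLam a (codeVar 3)))) (codeVar 0))))))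

/-- The Gödel number of `Tm.starRec`. -/
def codeStarRec (a b : ℕ) : ℕ :=
  codeLam a (codeLam (codeArrow codeConv (codeArrow a a)) (codeLam codeConv
    (codeApp (codeArrow codeNat a) (codeApp codeConv b (codeVar 0)) (codeLam codeNat
      (codeApp codeNat (codeApp (codeArrow codeNat (codeArrow a a))
        (codeApp a (codeRec a) (codeVar 3)) (codeLam codeNat (codeLam a
          (codeApp a (codeApp codeConv (codeVar 4) (codeApp codeNat codeConvConst (codeVar 1)))
            (codeVar 0))))) (codeVar 0))))))

theorem TTm.code_starIte {B : Type} (A : Ty B) {b : ℕ}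
    (hb : ∀ Γ : List TyT, TTm.code (Tm.bind A : TTm Γ _) = b) (Γ : List TyT) :
    TTm.code (Tm.starIte A : TTm Γ _) = codeStarIte (TyT.code (Ty.star A)) b := by
  simp only [Tm.starIte, TTm.code_lam, TTm.code_app, TTm.code_var, TTm.code_recr, hb,
    TyT.code_arrow]
  rfl

theorem TTm.code_starRec {B : Type} (A : Ty B) {b : ℕ}
    (hb : ∀ Γ : List TyT, TTm.code (Tm.bind A : TTm Γ _) = b) (Γ : List TyT) :
    TTm.code (Tm.starRec A : TTm Γ _) = codeStarRec (TyT.code (Ty.star A)) b := by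
  simp only [Tm.starRec, TTm.code_lam, TTm.code_app, TTm.code_var, TTm.code_recr, hb,
    TyT.code_arrow, TTm.code_convConst]
  rfl

/-- One step of the computation of the Gödel numbers of the type of `k`-ary predicates and of
`Tm.starCurry`. -/
def curryStep (c : ℕ) : ℕ :=
  Nat.pair (codeArrow codeConv c.unpair.1)
    (codeLam (codeArrow codeConv c.unpair.1) (codeLam codeConv (codeLam codeConv
      (codeApp codeConv
        (codeApp c.unpair.1 c.unpair.2 (codeApp codeConv (codeVar 2) (codeVar 0)))
        (codeApp codeConv (codeApp codeConv codeConvPairing (codeVar 1)) (codeVar 0))))))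

/-- The Gödel numbers of the type of `k`-ary predicates and of `Tm.starCurry`, where `d` is the
Gödel number of `Tm.starCurry` for `k = 0`. -/
def codeCurry (d : ℕ) : ℕ → ℕ
  | 0 => Nat.pair (codeArrow codeConv codeConv) d
  | k + 1 => curryStep (codeCurry d k)

theorem codeCurry_eq {B : Type} (A : Ty B)
    (D : ∀ Γ, TTm Γ (Ty.nat ⇒ₜ (Ty.conv .nat ⇒ₜ Ty.conv .nat) ⇒ₜ Ty.conv .nat ⇒ₜ Ty.star A))
    (p : ℕ) {d : ℕ} (hD : ∀ Γ, TTm.code (D Γ) = d) (k : ℕ) :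
    ∀ Γ : List TyT, codeCurry (codeApp codeNat d (codeNumeral p)) k =
      Nat.pair (TyT.code (Ty.star (Ty.curry k (Ty.nat ⇒ₜ Ty.bool) : TyT)))
        (TTm.code (Tm.starCurry A D p k : TTm Γ _)) := by
  induction k with
  | zero =>
    intro Γ
    rw [codeCurry, ← hD Γ, ← TTm.code_numeral (Γ := Γ)]
    rfl
  | succ k ih =>
    intro Γ
    rw [codeCurry, ih (_ :: _ :: _ :: Γ), curryStep, Nat.unpair_pair]
    refine congrArg (Nat.pair _) ?_
    rw [← TTm.code_convPairing]
    rfl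

end Irreducible

section Irreducible

attribute [local irreducible] Nat.pair

/-- The Gödel number of the translation of an oracle constant, where `d` is the Gödel number of the
translation of the constant for unary predicates, `P` that of the predicate and `t` that of its
translation. -/
def codeOracle (d P t : ℕ) : ℕ :=
  codeApp codeConv
    (codeApp (codeCurry (codeApp codeNat d (codeNumeral P)) P.unpair.1).unpair.1
      (codeCurry (codeApp codeNat d (codeNumeral P)) P.unpair.1).unpair.2 t)
    (codeApp codeNat codeConvConst codeZero)

def codeStarOracle : ℕ := TTm.code (Tm.starOracle : TTm [] _)
def codeStarSkolem : ℕ := TTm.code (Tm.starSkolem : TTm [] _)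
def codeStarAdd : ℕ := TTm.code (Tm.starAdd : TTm [] _)
def codeStarSt : ℕ := TTm.code (ClassConst.star _ (.st .empty) : TTm [] _)
def codeStarCup : ℕ := TTm.code (Tm.convCup : TTm [] _)

/-- The Gödel number of the translation of a constant with Gödel number `c`, where `t` is the
Gödel number of the translation of the predicate. -/
def codeStarConst (c t : ℕ) : ℕ :=
  if c.unpair.1 = 0 then codeStarSt
  else if c.unpair.1 = 1 then codeStarCup
  else if c.unpair.1 = 2 then codeOracle codeStarOracle c.unpair.2 t
  else if c.unpair.1 = 3 then codeOracle codeStarSkolem c.unpair.2 t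
  else codeOracle codeStarAdd c.unpair.2 t

/-- One step of the computation of the Gödel number of the translation of a term. -/
def termStep (l : List ℕ) : ℕ :=
  if l.length.unpair.1 = 0 then l.length
  else if l.length.unpair.1 = 1 then
    codeStarConst l.length.unpair.2 (l.getD l.length.unpair.2.unpair.2.unpair.2 0)
  else if l.length.unpair.1 = 2 then codeApp codeNat codeConvConst codeZero
  else if l.length.unpair.1 = 3 then codeApp codeNat codeConvConst codeZero
  else if l.length.unpair.1 = 4 then codeApp codeNat codeConvConst (codeSucc codeZero)
  else if l.length.unpair.1 = 5 then
    codeStarIte (codeTypeBind l.length.unpair.2).unpair.1 (codeTypeBind l.length.unpair.2).unpair.2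
  else if l.length.unpair.1 = 6 then
    codeStarRec (codeTypeBind l.length.unpair.2).unpair.1 (codeTypeBind l.length.unpair.2).unpair.2
  else if l.length.unpair.1 = 7 then
    codeApp codeConv codeConvSucc (l.getD l.length.unpair.2 0)
  else if l.length.unpair.1 = 8 then
    codeApp (codeTypeBind l.length.unpair.2.unpair.1).unpair.1
      (l.getD l.length.unpair.2.unpair.2.unpair.1 0) (l.getD l.length.unpair.2.unpair.2.unpair.2 0)
  else if l.length.unpair.1 = 9 then
    codeFst (codeTypeBind l.length.unpair.2.unpair.1).unpair.1
      (l.getD l.length.unpair.2.unpair.2 0)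
  else if l.length.unpair.1 = 10 then
    codeSnd (codeTypeBind l.length.unpair.2.unpair.1).unpair.1
      (l.getD l.length.unpair.2.unpair.2 0)
  else if l.length.unpair.1 = 11 then
    codePair (l.getD l.length.unpair.2.unpair.1 0) (l.getD l.length.unpair.2.unpair.2 0)
  else
    codeLam (codeTypeBind l.length.unpair.2.unpair.1).unpair.1
      (l.getD l.length.unpair.2.unpair.2 0)

/-- The Gödel number of the translation of a term. -/
def codeStar (t : ℕ) : ℕ := recCode termStep t

/-- For a constant attached to a predicate the inner number is the code of the predicate's term, so
the recursion translates that term as well. For states and union this number is not used. -/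
theorem codeStar_const (c : ℕ) :
    codeStar (Nat.pair 1 c) = codeStarConst c (codeStar c.unpair.2.unpair.2) := by
  have h : c.unpair.2.unpair.2 < Nat.pair 1 c :=
    ((Nat.unpair_right_le _).trans (Nat.unpair_right_le _)).trans_lt (lt_pair_succ 0 c)
  rw [codeStar, recCode, termStep, recValues_length, Nat.unpair_pair]
  simp only [reduceIte, one_ne_zero]
  rw [recValues_getD _ h]
  rfl

/-- Generality in the system matters: the lemma is applied to the predicates, which are terms of
system T, and through them to the constants of `T_Class`. -/
theorem codeStar_code {B : Type} {C : Ty B → Type} (cB : B → ℕ) (cC : ∀ A, C A → ℕ)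
    (c' : ∀ A, C A → TTm [] (Ty.star A))
    (hC : ∀ A c, TTm.code (c' A c) = codeStar (Nat.pair 1 (cC A c))) {Γ : List (Ty B)} {A : Ty B}
    (t : Tm C Γ A) : codeStar (t.code cB cC) = TTm.code (t.star c') := by
  have hstep : ∀ n, codeStar n = termStep (recValues termStep n) := fun n => rfl
  have hget : ∀ {i n : ℕ}, i < n → (recValues termStep n).getD i 0 = codeStar i :=
    fun h => recValues_getD _ h
  have hidx : ∀ {Γ : List (Ty B)} {A : Ty B} (v : Var Γ A),
      (Var.star v : Var (Γ.map (Ty.star (B' := Empty))) _).index = v.index := by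
    intro Γ A v
    induction v with
    | z => rfl
    | s v ih => exact congrArg (· + 1) ih
  induction t with
  | var v =>
    simp only [hstep, termStep, recValues_length, Tm.code, Nat.unpair_pair, if_true]
    exact congrArg codeVar (hidx v).symm
  | const c => exact (hC _ c).symm.trans (TTm.code_weak _).symm
  | zero =>
    simp only [hstep, termStep, recValues_length, Tm.code, Nat.unpair_pair, reduceIte,
      OfNat.ofNat_ne_zero, OfNat.ofNat_ne_one, Nat.reduceEqDiff]
    rfl
  | tt =>
    simp only [hstep, termStep, recValues_length, Tm.code, Nat.unpair_pair, reduceIte,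
      OfNat.ofNat_ne_zero, OfNat.ofNat_ne_one, Nat.reduceEqDiff]
    rfl
  | ff =>
    simp only [hstep, termStep, recValues_length, Tm.code, Nat.unpair_pair, reduceIte,
      OfNat.ofNat_ne_zero, OfNat.ofNat_ne_one, Nat.reduceEqDiff]
    rfl
  | ite A =>
    simp only [hstep, termStep, recValues_length, Tm.code, Nat.unpair_pair, reduceIte,
      OfNat.ofNat_ne_zero, OfNat.ofNat_ne_one, Nat.reduceEqDiff, codeTypeBind_code cB A []]
    refine (TTm.code_starIte A (fun Γ => ?_) _).symm
    exact (Nat.pair_eq_pair.1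
      ((codeTypeBind_code cB A Γ).symm.trans (codeTypeBind_code cB A []))).2
  | recr A =>
    simp only [hstep, termStep, recValues_length, Tm.code, Nat.unpair_pair, reduceIte,
      OfNat.ofNat_ne_zero, OfNat.ofNat_ne_one, Nat.reduceEqDiff, codeTypeBind_code cB A []]
    refine (TTm.code_starRec A (fun Γ => ?_) _).symm
    exact (Nat.pair_eq_pair.1
      ((codeTypeBind_code cB A Γ).symm.trans (codeTypeBind_code cB A []))).2
  | succ t ih =>
    have h := lt_pair_succ 6 (Tm.code cB cC t)
    simp only [hstep, termStep, recValues_length, Tm.code, Nat.unpair_pair, reduceIte,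
      OfNat.ofNat_ne_zero, OfNat.ofNat_ne_one, Nat.reduceEqDiff]
    rw [hget h, ih, ← TTm.code_convSucc]
    rfl
  | app t u iht ihu =>
    rename_i U V
    have h := lt_pair_succ 7
      (Nat.pair (Ty.code cB U) (Nat.pair (Tm.code cB cC t) (Tm.code cB cC u)))
    have h' := (Nat.right_le_pair (Ty.code cB U)
      (Nat.pair (Tm.code cB cC t) (Tm.code cB cC u))).trans_lt h
    simp only [hstep, termStep, recValues_length, Tm.code, Nat.unpair_pair, reduceIte,
      OfNat.ofNat_ne_zero, OfNat.ofNat_ne_one, Nat.reduceEqDiff, codeTypeBind_code cB U []]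
    rw [hget ((Nat.left_le_pair _ _).trans_lt h'), hget ((Nat.right_le_pair _ _).trans_lt h'),
      iht, ihu]
    rfl
  | fst t ih =>
    rename_i U V
    have h := lt_pair_succ 8 (Nat.pair (Ty.code cB V) (Tm.code cB cC t))
    simp only [hstep, termStep, recValues_length, Tm.code, Nat.unpair_pair, reduceIte,
      OfNat.ofNat_ne_zero, OfNat.ofNat_ne_one, Nat.reduceEqDiff, codeTypeBind_code cB V []]
    rw [hget ((Nat.right_le_pair _ _).trans_lt h), ih]
    rfl
  | snd t ih =>
    rename_i U V
    have h := lt_pair_succ 9 (Nat.pair (Ty.code cB U) (Tm.code cB cC t))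
    simp only [hstep, termStep, recValues_length, Tm.code, Nat.unpair_pair, reduceIte,
      OfNat.ofNat_ne_zero, OfNat.ofNat_ne_one, Nat.reduceEqDiff, codeTypeBind_code cB U []]
    rw [hget ((Nat.right_le_pair _ _).trans_lt h), ih]
    rfl
  | pair t u iht ihu =>
    have h := lt_pair_succ 10 (Nat.pair (Tm.code cB cC t) (Tm.code cB cC u))
    simp only [hstep, termStep, recValues_length, Tm.code, Nat.unpair_pair, reduceIte,
      OfNat.ofNat_ne_zero, OfNat.ofNat_ne_one, Nat.reduceEqDiff]
    rw [hget ((Nat.left_le_pair _ _).trans_lt h), hget ((Nat.right_le_pair _ _).trans_lt h),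
      iht, ihu]
    rfl
  | lam t ih =>
    rename_i U V
    have h := lt_pair_succ 11 (Nat.pair (Ty.code cB U) (Tm.code cB cC t))
    simp only [hstep, termStep, recValues_length, Tm.code, Nat.unpair_pair, reduceIte,
      OfNat.ofNat_ne_zero, OfNat.ofNat_ne_one, Nat.reduceEqDiff, codeTypeBind_code cB U []]
    rw [hget ((Nat.right_le_pair _ _).trans_lt h), ih]
    rfl

theorem Pred.codeStar_tm (P : Pred) : codeStar (TTm.code P.tm) =
    TTm.code (Tm.star (B' := Empty) (C' := NoConst) (fun _ c => nomatch c) P.tm) :=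
  codeStar_code _ _ _ (fun _ c => nomatch c) P.tm

theorem codeOracle_eq (P : Pred) (A : TyS)
    (D : ∀ Γ, TTm Γ (Ty.nat ⇒ₜ (Ty.conv .nat ⇒ₜ Ty.conv .nat) ⇒ₜ Ty.conv .nat ⇒ₜ Ty.star A))
    {d : ℕ} (hD : ∀ Γ, TTm.code (D Γ) = d) :
    TTm.code (.app (.app (Tm.starCurry A D P.code P.k) (.star (fun _ c => nomatch c) P.tm))
        (.app (.convConst .nat) .zero) : TTm [] _) =
      codeOracle d P.code (codeStar P.code.unpair.2) := by
  have e : P.code.unpair = (P.k, TTm.code P.tm) := Nat.unpair_pair _ _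
  rw [codeOracle, e, Pred.codeStar_tm, codeCurry_eq A D P.code hD P.k [], Nat.unpair_pair,
    ← TTm.code_convConst (Γ := [])]
  rfl

theorem ClassConst.code_star (A : TyS) (c : ClassConst A) :
    TTm.code (ClassConst.star A c) = codeStar (Nat.pair 1 (ClassConst.code A c)) := by
  rw [codeStar_const]
  cases c with
  -- The code of the state is never inspected, so its computability plays no role.
  | st S =>
    simp only [codeStarConst, ClassConst.code, Nat.unpair_pair, reduceIte]
    rfl
  | cup =>
    simp only [codeStarConst, ClassConst.code, Nat.unpair_pair, reduceIte, one_ne_zero]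
    rfl
  | oracle P =>
    simp only [codeStarConst, ClassConst.code, Nat.unpair_pair, reduceIte, OfNat.ofNat_ne_zero,
      OfNat.ofNat_ne_one]
    exact codeOracle_eq P Ty.bool (fun _ => .starOracle)
      fun Γ => TTm.code_weak (Γ := Γ) (Tm.starOracle : TTm [] _)
  | skolem P =>
    simp only [codeStarConst, ClassConst.code, Nat.unpair_pair, reduceIte, OfNat.ofNat_ne_zero,
      OfNat.ofNat_ne_one, Nat.reduceEqDiff]
    exact codeOracle_eq P Ty.nat (fun _ => .starSkolem)
      fun Γ => TTm.code_weak (Γ := Γ) (Tm.starSkolem : TTm [] _)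
  | add P =>
    simp only [codeStarConst, ClassConst.code, Nat.unpair_pair, reduceIte, OfNat.ofNat_ne_zero,
      OfNat.ofNat_ne_one, Nat.reduceEqDiff]
    exact codeOracle_eq P (Ty.nat ⇒ₜ TyS.state) (fun _ => .starAdd)
      fun Γ => TTm.code_weak (Γ := Γ) (Tm.starAdd : TTm [] _)

theorem ClassTm.codeStar_code {Γ : List TyS} {A : TyS} (t : ClassTm Γ A) :
    codeStar (ClassTm.code t) = TTm.code (t.star ClassConst.star) :=
  LearningRealizability.codeStar_code _ _ _ ClassConst.code_star t

end Irreducible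

/-! ## Computability -/

section Computability

attribute [local irreducible] Nat.pair Nat.unpair codeVar codeZero codeRec codeSucc codeApp codeFst
  codeSnd codePair codeLam codeProd codeArrow codeNat codeConv codeConvRep codeConvConst
  codeConvSucc codeConvPairing codeConvBind codeConvBindRep codeStarIte codeStarRec codeOracle
  codeStarOracle codeStarSkolem codeStarAdd codeStarSt codeStarCup codeStarConst codeTypeBind

theorem codeTypeBind_primrec : Primrec codeTypeBind := by
  unfold codeTypeBind
  refine recCode_primrec ?_
  have hn : Primrec fun l : List ℕ => l.length := Primrec.list_length
  unfold typeStep codeBindProd codeBindArrow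
  repeat first
    | exact Primrec.const _
    | exact hn
    | exact Primrec.id
    | refine primrec_ite_eq _ ?_ ?_ ?_
    | refine primrec_left ?_
    | refine primrec_right ?_
    | refine primrec_getD ?_ ?_
    | refine codeApp_primrec ?_ ?_ ?_
    | refine codeLam_primrec ?_ ?_
    | refine codePair_primrec ?_ ?_
    | refine codeFst_primrec ?_ ?_
    | refine codeSnd_primrec ?_ ?_
    | refine codeProd_primrec ?_ ?_
    | refine codeArrow_primrec ?_ ?_
    | refine primrec_pair ?_ ?_

theorem curryStep_primrec : Primrec curryStep := by
  unfold curryStep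
  repeat first
    | exact Primrec.const _
    | exact Primrec.id
    | refine primrec_left ?_
    | refine primrec_right ?_
    | refine codeApp_primrec ?_ ?_ ?_
    | refine codeLam_primrec ?_ ?_
    | refine codeArrow_primrec ?_ ?_
    | refine primrec_pair ?_ ?_

theorem codeCurry_primrec : Primrec₂ codeCurry := by
  refine (Primrec.nat_rec (f := fun d => Nat.pair (codeArrow codeConv codeConv) d)
    (g := fun (_ : ℕ) (x : ℕ × ℕ) => curryStep x.2) (primrec_pair (.const _) .id)
    (curryStep_primrec.comp (Primrec.snd.comp .snd)).to₂).of_eq fun d k => ?_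
  induction k with
  | zero => rfl
  | succ k ih => exact congrArg curryStep ih

section Primrec

variable {α : Type} [Primcodable α] {f g h : α → ℕ}

theorem codeOracle_primrec (d : ℕ) (hg : Primrec g) (hh : Primrec h) :
    Primrec fun x => codeOracle d (g x) (h x) := by
  have hc : Primrec fun x =>
      codeCurry (codeApp codeNat d (codeNumeral (g x))) (g x).unpair.1 :=
    codeCurry_primrec.comp
      (codeApp_primrec (.const _) (.const _) (codeNumeral_primrec.comp hg)) (primrec_left hg)
  unfold codeOracle
  exact codeApp_primrec (.const _) (codeApp_primrec (primrec_left hc) (primrec_right hc) hh)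
    (.const _)

theorem codeStarConst_primrec (hg : Primrec g) (hh : Primrec h) :
    Primrec fun x => codeStarConst (g x) (h x) := by
  unfold codeStarConst
  exact primrec_ite_eq 0 (primrec_left hg) (.const _) (primrec_ite_eq 1 (primrec_left hg) (.const _)
    (primrec_ite_eq 2 (primrec_left hg) (codeOracle_primrec _ (primrec_right hg) hh)
      (primrec_ite_eq 3 (primrec_left hg) (codeOracle_primrec _ (primrec_right hg) hh)
        (codeOracle_primrec _ (primrec_right hg) hh))))

theorem codeStarIte_primrec (hf : Primrec f) (hg : Primrec g) :
    Primrec fun x => codeStarIte (f x) (g x) := by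
  unfold codeStarIte
  repeat first
    | exact Primrec.const _
    | exact hf
    | exact hg
    | refine codeApp_primrec ?_ ?_ ?_
    | refine codeLam_primrec ?_ ?_
    | refine codeArrow_primrec ?_ ?_
    | refine codeRec_primrec ?_

theorem codeStarRec_primrec (hf : Primrec f) (hg : Primrec g) :
    Primrec fun x => codeStarRec (f x) (g x) := by
  unfold codeStarRec
  repeat first
    | exact Primrec.const _
    | exact hf
    | exact hg
    | refine codeApp_primrec ?_ ?_ ?_
    | refine codeLam_primrec ?_ ?_
    | refine codeArrow_primrec ?_ ?_
    | refine codeRec_primrec ?_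

end Primrec

theorem codeStar_primrec : Primrec codeStar := by
  refine recCode_primrec ?_
  have hn : Primrec fun l : List ℕ => l.length := Primrec.list_length
  have ht : ∀ {f : List ℕ → ℕ}, Primrec f → Primrec fun l => codeTypeBind (f l) :=
    fun hf => codeTypeBind_primrec.comp hf
  unfold termStep
  repeat first
    | exact Primrec.const _
    | exact hn
    | exact Primrec.id
    | refine primrec_ite_eq _ ?_ ?_ ?_
    | refine codeApp_primrec ?_ ?_ ?_
    | refine codeLam_primrec ?_ ?_
    | refine codePair_primrec ?_ ?_
    | refine codeFst_primrec ?_ ?_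
    | refine codeSnd_primrec ?_ ?_
    | refine codeStarConst_primrec ?_ ?_
    | refine codeStarIte_primrec ?_ ?_
    | refine codeStarRec_primrec ?_ ?_
    | refine primrec_left ?_
    | refine primrec_right ?_
    | refine primrec_getD ?_ ?_
    | refine ht ?_

end Computability

/-! ## Zeros and extracted programs -/

/-- The term computing a zero of `t n` by learning. -/
def ClassTm.zero (t : ClassTm [] (Ty.nat ⇒ₜ TyS.state)) : LearnTm [] (Ty.nat ⇒ₜ TyS.state) :=
  .lam (.app (.app (.app (.recr TyS.state) (LearnTm.st .empty))
    (.lam (.lam (.app (.app (.const .cup) (.var .z))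
      (.app (.app (.weak (.lam (ClassTm.abstract t))) (.var .z)) (.var (.s (.s .z))))))))
    (.app (.app .learningSteps (.weak (t.star ClassConst.star))) (.var .z)))

/-- The program of system T extracted from a realizer. -/
def ClassTm.program (t : ClassTm [] (Ty.nat ⇒ₜ .prod .nat TyS.state)) :
    TTm [] (Ty.nat ⇒ₜ Ty.nat) :=
  .app .extract (t.star ClassConst.star)

/-- The value of `t n` at a state. -/
noncomputable def ClassTm.valueAt {A : TyS} (t : ClassTm [] (Ty.nat ⇒ₜ A)) (n : ℕ)
    (S : KState) : A.den :=
  t.eval (ClassTm.interp S) Env.nil n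

theorem ClassTm.starRel_valueAt {B' : Type} {C' : Ty B' → Type} (I' : Interp C') {A : TyS}
    (t : ClassTm [] (Ty.nat ⇒ₜ A)) (ht : t.StateEmpty) (n : ℕ) {Γ : List (Ty B')} (ρ : Env Γ) :
    Ty.StarRel A
      ((t.star ClassConst.star : Tm C' [] (Ty.star (Ty.nat ⇒ₜ A))).eval I' Env.nil
        ((Tm.convConst Ty.nat).eval I' ρ n))
      (t.valueAt n) :=
  t.starRel_star I' ht _ (fun _ => n) (Converges.const (X := .nat) I' ρ n)

theorem ClassTm.eval_app_numeral {A : TyS} (t : ClassTm [] (Ty.nat ⇒ₜ A)) (n : ℕ) (S : KState) :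
    (ClassTm.approx S (.app t (.numeral n))).eval LearnTm.interp Env.nil = t.valueAt n S :=
  (ClassTm.eval_approx S _ _).trans
    (congrArg (t.eval (ClassTm.interp S) Env.nil) (Tm.eval_numeral _ n _))

/-- The recursion on genuine states follows `KState.learn`. The environment is only the one in which
the step count happens to be evaluated; stationarity holds for any. -/
theorem ClassTm.eval_zero (t : ClassTm [] (Ty.nat ⇒ₜ TyS.state)) (n : ℕ) :
    ∃ (Γ : List TyS) (ρ : Env Γ), t.zero.eval LearnTm.interp Env.nil n =
      KState.learn (t.valueAt n) (Tm.stationary.eval LearnTm.interp ρ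
        ((t.star ClassConst.star : LearnTm [] (Ty.star (Ty.nat ⇒ₜ TyS.state))).eval
          LearnTm.interp Env.nil ((Tm.convConst Ty.nat).eval LearnTm.interp ρ n))) := by
  let T := (t.star ClassConst.star : LearnTm [] (Ty.star (Ty.nat ⇒ₜ TyS.state))).eval
    LearnTm.interp Env.nil
  let ρ₀ : Env [(Ty.nat : TyS)] := Env.cons (U := .nat) n Env.nil
  refine ⟨_, Env.cons (U := .nat) n (Env.cons T ρ₀), ?_⟩
  have hT : Tm.eval LearnTm.interp (.weak (t.star ClassConst.star :
      LearnTm [] (Ty.star (Ty.nat ⇒ₜ TyS.state)))) ρ₀ = T := Tm.eval_weak _ _ _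
  have hstep : ∀ j : ℕ, (Nat.rec KState.empty (fun i (S : KState) => S.cup
      ((Tm.eval LearnTm.interp (.weak (.lam (ClassTm.abstract t)))
        (Env.cons (U := TyS.state) S (Env.cons (U := .nat) i ρ₀))) S n)) j : KState) =
      KState.learn (t.valueAt n) j := by
    intro j
    induction j with
    | zero => rfl
    | succ j ih =>
      have h : ∀ (S : KState) (i : ℕ), (Tm.eval LearnTm.interp (.weak (.lam (ClassTm.abstract t)))
          (Env.cons (U := TyS.state) S (Env.cons (U := .nat) i ρ₀))) S n = t.valueAt n S := by
        intro S i
        refine (congrFun (congrFun (Tm.eval_weak LearnTm.interp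
          (.lam (ClassTm.abstract t)) _) S) n).trans ?_
        refine (congrFun (ClassTm.eval_abstract t (Env.cons (U := TyS.state) S Env.nil)) n).trans ?_
        exact congrArg (fun ρ => t.eval (ClassTm.interp S) ρ n) (Env.eq_nil _)
      refine (congrArg (KState.cup _) (h _ j)).trans ?_
      rw [ih]
      rfl
  refine Eq.trans ?_ (hstep _)
  exact congrArg (fun T' : (Ty.star (Ty.nat ⇒ₜ TyS.state) : TyS).den =>
    (Nat.rec KState.empty (fun i (S : KState) => S.cup
      ((Tm.eval LearnTm.interp (.weak (.lam (ClassTm.abstract t)))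
        (Env.cons (U := TyS.state) S (Env.cons (U := .nat) i ρ₀))) S n))
      (Tm.stationary.eval LearnTm.interp (Env.cons (U := .nat) n (Env.cons T' ρ₀))
        (T' ((Tm.convConst Ty.nat).eval LearnTm.interp
          (Env.cons (U := .nat) n (Env.cons T' ρ₀)) n))) : KState)) hT

theorem ClassTm.exists_zero (t : ClassTm [] (Ty.nat ⇒ₜ TyS.state)) (ht : t.StateEmpty) (n : ℕ) :
    ∃ S : KState, LearnEq (.app t.zero (.numeral n)) (LearnTm.st S) ∧
      LearnEq (ClassTm.approx S (.app t (.numeral n))) (LearnTm.st .empty) := by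
  obtain ⟨Γ, ρ, h⟩ := t.eval_zero n
  have hR := t.starRel_valueAt LearnTm.interp ht n ρ
  exact ⟨_, LearnTm.eq_st.2
      ((congrArg (t.zero.eval LearnTm.interp Env.nil) (Tm.eval_numeral _ n _)).trans h),
    LearnTm.eq_st.2 ((t.eval_app_numeral n _).trans
      (KState.learn_stationary LearnTm.interp ρ hR.1 hR.2))⟩

theorem ClassTm.program_spec (t : ClassTm [] (Ty.nat ⇒ₜ .prod .nat TyS.state))
    (ht : t.StateEmpty) (n : ℕ) :
    ∃ S : KState, (t.valueAt n S).1 = t.program.eval TTm.interp Env.nil n ∧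
      (t.valueAt n S).2 = KState.empty := by
  let T := (t.star ClassConst.star : TTm [] (Ty.star (Ty.nat ⇒ₜ .prod .nat TyS.state))).eval
    TTm.interp Env.nil
  let ρ : Env [(Ty.nat : TyT), _] := Env.cons (U := .nat) n (Env.cons T Env.nil)
  have h := t.starRel_valueAt TTm.interp ht n ρ
  let k := T ((Tm.convConst Ty.nat).eval TTm.interp ρ n)
  let ρ' := Env.cons k ρ
  refine ⟨KState.learn (fun S => (t.valueAt n S).2) (Tm.stationary.eval TTm.interp ρ' k.2), ?_,
    KState.learn_stationary TTm.interp ρ' h.2.1 h.2.2⟩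
  -- The first component of the translation gives the exact value at a represented state, so the
  -- program's output is the witness at the state reached by learning.
  refine (h.1.1 _).symm.trans (congrArg k.1.1 ?_)
  exact (KState.eval_learning TTm.interp ρ' h.2.1 _).symm

theorem ClassTm.code_program (t : ClassTm [] (Ty.nat ⇒ₜ .prod .nat TyS.state)) :
    TTm.code t.program = codeApp (TyT.code (Ty.star (Ty.nat ⇒ₜ .prod .nat TyS.state)))
      (TTm.code (Tm.extract : TTm [] _)) (codeStar (ClassTm.code t)) :=
  (TTm.code_app _ _).trans (congrArg (codeApp _ _) (ClassTm.codeStar_code t).symm)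

theorem AtomicT.eval_at_congr (P : AtomicT) (a : TTm [] Ty.nat) {b b' : TTm [] Ty.nat}
    (h : b.eval TTm.interp Env.nil = b'.eval TTm.interp Env.nil) :
    (P.at a b).eval TTm.interp Env.nil = (P.at a b').eval TTm.interp Env.nil := by
  rw [AtomicT.at, AtomicT.at, Tm.eval_apps, Tm.eval_apps]
  refine congrArg _ (funext fun i => ?_)
  rw [Tm.eval_sub, Tm.eval_sub]
  congr 1
  funext A v
  rcases v with _ | (_ | v)
  · exact h
  · rfl
  · cases v

theorem AtomicT.teq_of_realizes (P : AtomicT) (t : ClassTm [] P.forallExists.rtype)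
    (ht : Realizes P.forallExists t) (n : ℕ) :
    TEq (P.at (.numeral n) (.app (ClassTm.program t) (.numeral n))) .tt := by
  obtain ⟨S, h₁, h₂⟩ := ClassTm.program_spec t ht.1 n
  obtain ⟨m, hm, hS⟩ := ht.2 S n
  have hv := ClassTm.eval_app_numeral t n S
  -- The witness promised by the realizer at S is a numeral; by soundness it is the value of the
  -- program.
  have hm' : m = (ClassTm.program t).eval TTm.interp Env.nil n := by
    refine Eq.trans ?_ h₁
    refine (Tm.eval_numeral LearnTm.interp m Env.nil).symm.trans ?_
    exact (LearnTm.eval_eq hm Env.nil).symm.trans (congrArg Prod.fst hv)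
  -- At S the state part of the realizer is empty, so the realizability condition asserts the truth
  -- of the atomic formula.
  have hP := hS (LearnTm.eq_st.2 ((congrArg Prod.snd hv).trans h₂))
  have hP' := (ClassTm.eval_approx S _ Env.nil).symm.trans (LearnTm.eval_eq hP Env.nil)
  have hP'' := (P.eval_class (ClassTm.interp S) n m).symm.trans hP'
  refine TTm.teq_tt.2 ((P.eval_at_congr _ ?_).trans hP'')
  exact (congrArg ((ClassTm.program t).eval TTm.interp Env.nil)
    (Tm.eval_numeral _ n _)).trans (hm'.symm.trans (Tm.eval_numeral TTm.interp m Env.nil).symm)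

end LearningRealizability

theorem mainTheorem5 :
    (∀ t : ClassTm [] (Ty.nat ⇒ₜ TyS.state), ClassTm.StateEmpty t →
      ∃ Zero : LearnTm [] (Ty.nat ⇒ₜ TyS.state), ∀ n : ℕ, ∃ S : KState,
        LearnEq (Tm.app Zero (Tm.numeral n)) (LearnTm.st S) ∧
        LearnEq (ClassTm.approx S (Tm.app t (Tm.numeral n))) (LearnTm.st KState.empty)) ∧
    (∃ F : ℕ → ℕ, Computable F ∧
      ∀ (P : AtomicT) (t : ClassTm [] P.forallExists.rtype), Realizes P.forallExists t →
        ∃ u : TTm [] (Ty.nat ⇒ₜ Ty.nat), TTm.code u = F (ClassTm.code t) ∧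
          ∀ n : ℕ, TEq (P.at (Tm.numeral n) (Tm.app u (Tm.numeral n))) Tm.tt) := by
  -- The function on Gödel numbers applies the fixed term `Tm.extract` to the translation of t.
  exact ⟨fun t ht => ⟨t.zero, t.exists_zero ht⟩, _,
    (codeApp_primrec (.const _) (.const _) codeStar_primrec).to_comp, fun P t ht =>
      ⟨ClassTm.program t, ClassTm.code_program t, P.teq_of_realizes t ht⟩⟩
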